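/- **Proposition 3.1.** Let $\Lambda(t)=-\int_0^t\ln|2\sin u|\,du$ be the Lobachevsky function and, for $x=(x_1,x_2,x_3)$, put $x_i^*=\frac12(\pi+x_i-x_j-x_k)$, where $\{i,j,k\}=\{1,2,3\}$. Let $$M_3=\{x\in(0,\pi)^3 : x_1+x_2+x_3>\pi,\ x_i^*>0\ (i=1,2,3)\},\qquad H_3=\{x\in(0,\pi)^3 : x_1+x_2+x_3<\pi\}.$$ These are exactly the sets of triples of inner angles of (nondegenerate) spherical triangles in the unit sphere $S^2$ and of hyperbolic triangles in the hyperbolic plane of curvature $-1$, respectively, and the inner angles determine the edge lengths. For $x\in M_3$ (respectively $x\in H_3$) let $y_1,y_2,y_3$ be the edge lengths of the spherical (respectively hyperbolic) triangle with inner angles $x_1,x_2,x_3$, the $i$-th edge facing the $i$-th angle. For $x\in M_3$ and $x\in H_3$ respectively, the capacities $$\theta(x)=\int_{(\pi/2,\pi/2,\pi/2)}^{x}\sum_{i=1}^3\ln\tan(y_i/2)\,dx_i,\qquad \tilde\theta(x)=\int_{(0,0,0)}^{x}\sum_{i=1}^3\ln\tanh(y_i/2)\,dx_i$$ are well defined: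 the integrals exist and have the same value along all piecewise $C^1$ paths that lie in $M_3$, respectively in $H_3$ except for their initial point $(0,0,0)$. Moreover: 1. For $x\in M_3$, $\displaystyle \theta(x)=-\sum_{i=1}^3\Lambda(x_i^*)-\Lambda\Big(\frac{\pi+x_1+x_2+x_3}{2}\Big)+4\Lambda(\pi/4).$ 2. For $x\in H_3$, $\displaystyle \tilde\theta(x)=-\sum_{i=1}^3\Lambda(x_i^*)-\Lambda\Big(\frac{\pi+x_1+x_2+x_3}{2}\Big).$ 3. $\theta$ extends continuously to the closure $\overline{M_3}$, and $\tilde\theta$ extends continuously to the closure $\overline{H_3}$. 4. For every spherical triangle with inner angles $x=(x_1,x_2,x_3)$, regard $S^2$ as the sphere at infinity of hyperbolic 3-space. The three great circles bounding the triangle meet pairwise in exactly six points, and the hyperbolic convex hull of these six points (an ideal octahedron) has finite hyperbolic volume, equal to $8\Lambda(\pi/4)-2\theta(x)$. -/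

import Mathlib

open scoped RealInnerProductSpace

namespace TriangleCapacity

/-- The Lobachevsky function `Λ(t) = -∫₀ᵗ ln |2 sin u| du`. -/
noncomputable def lobachevsky (t : ℝ) : ℝ :=
  -∫ u in (0 : ℝ)..t, Real.log |2 * Real.sin u|

/-- `x*_i = (π + x_i - x_j - x_k) / 2` with `{i, j, k} = {1, 2, 3}`
(indices in `Fin 3` are added modulo `3`). -/
noncomputable def starAngle (x : Fin 3 → ℝ) (i : Fin 3) : ℝ :=
  (Real.pi + x i - x (i + 1) - x (i + 2)) / 2

/-- The open tetrahedron `M₃`. -/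
def sphericalDomain : Set (Fin 3 → ℝ) :=
  {x | (∀ i, 0 < x i ∧ x i < Real.pi) ∧ Real.pi < ∑ i, x i ∧ ∀ i, 0 < starAngle x i}

/-- The open simplex `{x ∈ (0, π)³ | x₁ + x₂ + x₃ < π}`. -/
def hyperbolicDomain : Set (Fin 3 → ℝ) :=
  {x | (∀ i, 0 < x i ∧ x i < Real.pi) ∧ ∑ i, x i < Real.pi}

/-! ### Spherical triangles -/

/-- Euclidean 3-space, in which the unit sphere is the 2-sphere. -/
abbrev E3 : Type := EuclideanSpace ℝ (Fin 3)

/-- A (nondegenerate, labelled) spherical triangle: three linearly independent unit vectors,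
joined pairwise by the shorter arcs of great circles. -/
structure SphericalTriangle where
  vertex : Fin 3 → E3
  norm_vertex : ∀ i, ‖vertex i‖ = 1
  linearIndependent : LinearIndependent ℝ vertex

namespace SphericalTriangle

/-- The length of the edge facing the `i`-th vertex. -/
noncomputable def edge (T : SphericalTriangle) (i : Fin 3) : ℝ :=
  InnerProductGeometry.angle (T.vertex (i + 1)) (T.vertex (i + 2))

/-- A vector tangent to the sphere at the `i`-th vertex, pointing along the arc
from the `i`-th vertex to the `j`-th vertex. -/
noncomputable def tangent (T : SphericalTriangle) (i j : Fin 3) : E3 :=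
  T.vertex j - ⟪T.vertex i, T.vertex j⟫ • T.vertex i

/-- The inner angle at the `i`-th vertex. -/
noncomputable def innerAngle (T : SphericalTriangle) (i : Fin 3) : ℝ :=
  InnerProductGeometry.angle (T.tangent i (i + 1)) (T.tangent i (i + 2))

/-- The great circle containing the edge facing the `i`-th vertex. -/
def boundingCircle (T : SphericalTriangle) (i : Fin 3) : Set E3 :=
  {p | ‖p‖ = 1 ∧ p ∈ Submodule.span ℝ {T.vertex (i + 1), T.vertex (i + 2)}}

/-- The points in which two of the three circles bounding the triangle meet. -/
def intersectionPoints (T : SphericalTriangle) : Set E3 :=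
  {p | ∃ i j, i ≠ j ∧ p ∈ T.boundingCircle i ∧ p ∈ T.boundingCircle j}

/-- The hyperbolic convex hull of the pairwise intersection points of the three bounding circles,
which are seen as points at infinity of the Klein model: hyperbolic geodesics
in this model are straight chords, so that the hyperbolic convex hull is the affine one. -/
def octahedron (T : SphericalTriangle) : Set E3 :=
  convexHull ℝ T.intersectionPoints

end SphericalTriangle

/-- The edge lengths `(y₁, y₂, y₃)` of a spherical triangle with inner angles `(x₁, x₂, x₃)`. -/
noncomputable def sphericalEdge (x : Fin 3 → ℝ) : Fin 3 → ℝ :=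
  Classical.epsilon fun y => ∃ T : SphericalTriangle, T.innerAngle = x ∧ T.edge = y

/-! ### Hyperbolic triangles, in the hyperboloid model of the hyperbolic plane -/

/-- The Lorentzian form on `ℝ^{2,1}`. -/
def lorentz (v w : Fin 3 → ℝ) : ℝ := v 0 * w 0 + v 1 * w 1 - v 2 * w 2

/-- A (nondegenerate, labelled) hyperbolic triangle: three points on the upper sheet of the
hyperboloid `lorentz v v = -1` which do not lie on a common geodesic. -/
structure HyperbolicTriangle where
  vertex : Fin 3 → Fin 3 → ℝ
  lorentz_vertex : ∀ i, lorentz (vertex i) (vertex i) = -1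
  vertex_pos : ∀ i, 0 < vertex i 2
  linearIndependent : LinearIndependent ℝ vertex

namespace HyperbolicTriangle

/-- The length of the edge facing the `i`-th vertex. The hyperbolic distance `d` of two points
`v`, `w` of the hyperboloid satisfies `cosh d = -lorentz v w`. -/
noncomputable def edge (T : HyperbolicTriangle) (i : Fin 3) : ℝ :=
  Real.arcosh (-lorentz (T.vertex (i + 1)) (T.vertex (i + 2)))

/-- A vector tangent to the hyperboloid at the `i`-th vertex, pointing along the geodesic
from the `i`-th vertex to the `j`-th vertex. -/
def tangent (T : HyperbolicTriangle) (i j : Fin 3) : Fin 3 → ℝ :=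
  T.vertex j + lorentz (T.vertex i) (T.vertex j) • T.vertex i

/-- The inner angle at the `i`-th vertex; the Lorentzian form is positive definite
on tangent spaces of the hyperboloid. -/
noncomputable def innerAngle (T : HyperbolicTriangle) (i : Fin 3) : ℝ :=
  Real.arccos (lorentz (T.tangent i (i + 1)) (T.tangent i (i + 2)) /
    (√(lorentz (T.tangent i (i + 1)) (T.tangent i (i + 1))) *
      √(lorentz (T.tangent i (i + 2)) (T.tangent i (i + 2)))))

end HyperbolicTriangle

/-- The edge lengths `(y₁, y₂, y₃)` of a hyperbolic triangle with inner angles `(x₁, x₂, x₃)`. -/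
noncomputable def hyperbolicEdge (x : Fin 3 → ℝ) : Fin 3 → ℝ :=
  Classical.epsilon fun y => ∃ T : HyperbolicTriangle, T.innerAngle = x ∧ T.edge = y

/-! ### The capacities -/

/-- The 1-form `∑ ln tan (y_i / 2) dx_i`. -/
noncomputable def sphericalForm (x : Fin 3 → ℝ) : (Fin 3 → ℝ) →L[ℝ] ℝ :=
  ∑ i, Real.log (Real.tan (sphericalEdge x i / 2)) • ContinuousLinearMap.proj i

/-- The 1-form `∑ ln tanh (y_i / 2) dx_i`. -/
noncomputable def hyperbolicForm (x : Fin 3 → ℝ) : (Fin 3 → ℝ) →L[ℝ] ℝ :=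
  ∑ i, Real.log (Real.tanh (hyperbolicEdge x i / 2)) • ContinuousLinearMap.proj i

/-- The point `(π/2, π/2, π/2)`. -/
noncomputable def basePoint : Fin 3 → ℝ := fun _ => Real.pi / 2

/-- The capacity `θ(x) = ∫_{(π/2, π/2, π/2)}^x ∑ ln tan (y_i / 2) dx_i`, integrated along the
straight segment. -/
noncomputable def sphericalCapacity (x : Fin 3 → ℝ) : ℝ :=
  curveIntegral sphericalForm (Path.segment basePoint x)

/-- The capacity `θ̃(x) = ∫_{(0, 0, 0)}^x ∑ ln tanh (y_i / 2) dx_i`, integrated along the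
straight segment. -/
noncomputable def hyperbolicCapacity (x : Fin 3 → ℝ) : ℝ :=
  curveIntegral hyperbolicForm (Path.segment 0 x)

/-- A path is piecewise `C¹` if it is `C¹`, up to the end points, on each closed subinterval of
`[0, 1]` whose interior avoids a certain finite set of break points. -/
def IsPiecewiseC1 {a b : Fin 3 → ℝ} (γ : Path a b) : Prop :=
  ∃ P : Finset ℝ, ∀ s t : ℝ, 0 ≤ s → s < t → t ≤ 1 → (∀ p ∈ P, p ∉ Set.Ioo s t) →
    ContDiffOn ℝ 1 γ.extend (Set.Icc s t)

/-! ### Hyperbolic volume in the Klein model -/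

/-- The Riemannian metric of hyperbolic 3-space in the Klein (projective) model,
at the point `p` of the open unit ball. -/
noncomputable def kleinMetric (p u v : E3) : ℝ :=
  ⟪u, v⟫ / (1 - ‖p‖ ^ 2) + ⟪p, u⟫ * ⟪p, v⟫ / (1 - ‖p‖ ^ 2) ^ 2

/-- The Riemannian volume density `√det g` of the Klein model. -/
noncomputable def kleinDensity (p : E3) : ℝ :=
  √(Matrix.of fun i j : Fin 3 =>
    kleinMetric p (EuclideanSpace.single i 1) (EuclideanSpace.single j 1)).det

/-- The hyperbolic volume of (the part in the open unit ball of) a set. -/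
noncomputable def hyperbolicVolume (A : Set E3) : ENNReal :=
  ∫⁻ p in A ∩ Metric.ball 0 1, ENNReal.ofReal (kleinDensity p)

end TriangleCapacity

namespace TriangleCapacity

open MeasureTheory Real Set Filter Topology

/-! Put σ = (π + x₁ + x₂ + x₃)/2. The second law of cosines gives the edge as a function of the
angles: its (hyperbolic) cosine is `edgeCos x i`, and sum-to-product turns (1 - cos yᵢ)/(1 + cos yᵢ)
into -sin σ sin xᵢ* / (sin xⱼ* sin xₖ*), with cosh for cos in the hyperbolic case. Half the
logarithm of its absolute value is ln tan(yᵢ/2), respectively ln tanh(yᵢ/2). Since Λ' = -ln|2 sin|,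
the same expression is the i-th partial derivative of -∑ Λ(xᵢ*) - Λ(σ), the `potential`. Hence both
forms are exact with one potential (`hasFDerivAt_potential`, `sphericalForm_eq`,
`hyperbolicForm_eq`). Path independence and the formulas follow from
`curveIntegral_eq_sub_of_isPiecewiseC1`; the potential is 0 at the origin and -4Λ(π/4) at the
spherical base point. Continuity of Λ gives the extensions to the closures.

The domains are recognized through 1 - `edgeCos`: it is positive on spherical triangles and negative
on hyperbolic ones. Conversely, a triangle is built explicitly from two edges and the angle between
them.

For the volume, the octahedron with vertices ±v₀, ±v₁, ±v₂ is cut along the axis from v₀ to -v₀ into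
four ideal tetrahedra. The one with vertices v₀, -v₀, v₁, v₂ has volume Λ(x₀) + Λ(x₁*) + Λ(x₂*) with
indices 0, 1, 2 (`SphericalTriangle.lintegral_tetrahedron`), computed by integrating the Klein
density in adapted barycentric weights. The other three are the same tetrahedron for adjacent
triangles, in which vertices are replaced by antipodes. In the sum the axis angles x₀ and π - x₀
cancel and every other angle occurs twice, which gives -2 `potential`. -/

/-! ### The Lobachevsky function. -/

theorem intervalIntegrable_log_sin' (a b : ℝ) :
    IntervalIntegrable (fun u => Real.log |2 * Real.sin u|) volume a b := by
  have h : IntervalIntegrable (fun u => Real.log 2 + Real.log (Real.sin u)) volume a b :=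
    intervalIntegrable_const.add intervalIntegrable_log_sin
  refine h.congr_ae ?_
  have hc : ({u : ℝ | Real.sin u = 0}).Countable := by
    have : {u : ℝ | Real.sin u = 0} = range fun n : ℤ => (n : ℝ) * π := by
      ext u; simp [Real.sin_eq_zero_iff]
    rw [this]; exact countable_range _
  refine ae_restrict_of_ae ?_
  filter_upwards [hc.ae_notMem volume] with u hu
  rw [Real.log_abs, Real.log_mul two_ne_zero hu]

theorem integral_log_sin_pi : ∫ u in (0 : ℝ)..π, Real.log |2 * Real.sin u| = 0 := by
  have : ∫ u in (0 : ℝ)..π, Real.log |2 * Real.sin u| =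
      ∫ u in (0 : ℝ)..π, (Real.log 2 + Real.log (Real.sin u)) := by
    rw [intervalIntegral.integral_of_le pi_pos.le, intervalIntegral.integral_of_le pi_pos.le,
      integral_Ioc_eq_integral_Ioo, integral_Ioc_eq_integral_Ioo]
    refine setIntegral_congr_fun measurableSet_Ioo fun u hu => ?_
    rw [Real.log_abs, Real.log_mul two_ne_zero (sin_pos_of_mem_Ioo hu).ne']
  rw [this, intervalIntegral.integral_add (g := fun u => Real.log (Real.sin u))
    intervalIntegrable_const intervalIntegrable_log_sin, integral_log_sin_zero_pi,
    intervalIntegral.integral_const, smul_eq_mul]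
  ring

theorem continuous_lobachevsky : Continuous lobachevsky :=
  (intervalIntegral.continuous_primitive intervalIntegrable_log_sin' 0).neg

theorem hasDerivAt_lobachevsky {t : ℝ} (ht : Real.sin t ≠ 0) :
    HasDerivAt lobachevsky (-Real.log |2 * Real.sin t|) t := by
  refine (intervalIntegral.integral_hasDerivAt_right (intervalIntegrable_log_sin' 0 t)
    ?_ ?_).neg
  · exact (Measurable.stronglyMeasurable (by fun_prop)).stronglyMeasurableAtFilter
  · exact ContinuousAt.log (by fun_prop) (by simpa using ht)

theorem integral_log_sin_eq (a b : ℝ) :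
    ∫ u in a..b, Real.log |2 * Real.sin u| = lobachevsky a - lobachevsky b := by
  have := intervalIntegral.integral_add_adjacent_intervals
    (intervalIntegrable_log_sin' 0 a) (intervalIntegrable_log_sin' a b)
  simp only [lobachevsky]
  linarith

theorem lobachevsky_zero : lobachevsky 0 = 0 := by simp [lobachevsky]

theorem lobachevsky_neg (t : ℝ) : lobachevsky (-t) = -lobachevsky t := by
  have h := intervalIntegral.integral_comp_neg (a := 0) (b := t)
    fun u => Real.log |2 * Real.sin u|
  simp only [Real.sin_neg, mul_neg, abs_neg, neg_zero] at h
  rw [lobachevsky, lobachevsky, intervalIntegral.integral_symm, ← h]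

/-- The integrand is π-periodic and has integral zero over a period (`integral_log_sin_pi`). -/
theorem lobachevsky_add_pi (t : ℝ) : lobachevsky (t + π) = lobachevsky t := by
  have h := intervalIntegral.integral_comp_add_right (a := 0) (b := t)
    (fun u => Real.log |2 * Real.sin u|) π
  simp only [Real.sin_add_pi, mul_neg, abs_neg, zero_add] at h
  have h2 := integral_log_sin_eq π (t + π)
  have h3 : lobachevsky π = 0 := by rw [lobachevsky, integral_log_sin_pi, neg_zero]
  rw [h3, ← h] at h2
  simp only [lobachevsky] at h2 ⊢
  linarith

theorem lobachevsky_pi_sub (t : ℝ) : lobachevsky (π - t) = -lobachevsky t := by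
  rw [sub_eq_neg_add, lobachevsky_add_pi, lobachevsky_neg]

theorem lobachevsky_pi_div_two : lobachevsky (π / 2) = 0 := by
  have := lobachevsky_pi_sub (π / 2)
  rw [sub_half] at this
  linarith

/-! ### Integrals of exact forms along piecewise C¹ paths. -/

/-- Induction on the break points: a point inside `(a, b)` splits the interval in two, and any other
point lies in no open subinterval. -/
theorem intervalIntegrable_of_forall_avoiding {f : ℝ → ℝ} (P : Finset ℝ) :
    ∀ {a b : ℝ}, a ≤ b → (∀ s t, a ≤ s → s < t → t ≤ b → (∀ p ∈ P, p ∉ Ioo s t) →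
      IntervalIntegrable f volume s t) → IntervalIntegrable f volume a b := by
  classical
  induction P using Finset.induction_on with
  | empty =>
    intro a b hab h
    rcases hab.eq_or_lt with rfl | hab
    · exact IntervalIntegrable.refl
    · exact h a b le_rfl hab le_rfl (by simp)
  | insert p P _ ih =>
    intro a b hab h
    by_cases hp : p ∈ Ioo a b
    · refine (ih hp.1.le fun s t hs hst ht hP => ?_).trans
        (ih hp.2.le fun s t hs hst ht hP => ?_)
      · refine h s t hs hst (ht.trans hp.2.le) fun q hq => ?_
        rcases Finset.mem_insert.1 hq with rfl | hq
        · exact fun hq' => absurd hq'.2 ht.not_gt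
        · exact hP q hq
      · refine h s t (hp.1.le.trans hs) hst ht fun q hq => ?_
        rcases Finset.mem_insert.1 hq with rfl | hq
        · exact fun hq' => absurd hq'.1 hs.not_gt
        · exact hP q hq
    · refine ih hab fun s t hs hst ht hP => h s t hs hst ht fun q hq => ?_
      rcases Finset.mem_insert.1 hq with rfl | hq
      · exact fun hq' => hp ⟨hs.trans_lt hq'.1, hq'.2.trans_le ht⟩
      · exact hP q hq

/-- The fundamental theorem of calculus along a piecewise `C¹` path whose initial point may lie on
the boundary of the domain `D` of the closed form `ω`, if `ω` extends continuously to it. -/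
theorem curveIntegral_eq_sub_of_isPiecewiseC1 {a b : Fin 3 → ℝ} {D : Set (Fin 3 → ℝ)}
    {ω ω' : (Fin 3 → ℝ) → (Fin 3 → ℝ) →L[ℝ] ℝ} {F : (Fin 3 → ℝ) → ℝ}
    (hF : Continuous F) (hFω : ∀ x ∈ D, HasFDerivAt F (ω x) x)
    (hω : ∀ x ∈ D, ω x = ω' x) (hω' : ∀ x ∈ insert a D, ContinuousAt ω' x)
    (γ : Path a b) (hγ : IsPiecewiseC1 γ) (hγD : ∀ t, t ≠ 0 → γ t ∈ D) :
    CurveIntegrable ω γ ∧ curveIntegral ω γ = F b - F a := by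
  obtain ⟨P, hP⟩ := hγ
  have hmem : ∀ u ∈ Ioc (0 : ℝ) 1, γ.extend u ∈ D := by
    intro u hu
    rw [γ.extend_apply ⟨hu.1.le, hu.2⟩]
    refine hγD _ fun h => hu.1.ne' ?_
    simpa using congrArg Subtype.val h
  have hmem' : ∀ u ∈ Icc (0 : ℝ) 1, γ.extend u ∈ insert a D := by
    intro u hu
    rcases hu.1.eq_or_lt with rfl | h
    · left; simp
    · exact Or.inr (hmem u ⟨h, hu.2⟩)
  have hint : CurveIntegrable ω γ := by
    refine intervalIntegrable_of_forall_avoiding P zero_le_one fun s t hs hst ht hPst => ?_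
    have hC := hP s t hs hst ht hPst
    have hd : ContinuousOn (derivWithin γ.extend (Icc s t)) (Icc s t) :=
      hC.continuousOn_derivWithin (uniqueDiffOn_Icc hst) le_rfl
    -- On a break-free `[s, t]` the integrand agrees almost everywhere with a function continuous up
    -- to both ends: the derivative is taken within `[s, t]`, and `ω'` replaces `ω`, about whose
    -- value at the initial point nothing is known.
    have hc : ContinuousOn
        (fun u => ω' (γ.extend u) (derivWithin γ.extend (Icc s t) u)) (Icc s t) := by
      refine ContinuousOn.clm_apply (fun u hu => ?_) hd
      exact ContinuousAt.comp_continuousWithinAt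
        (hω' _ (hmem' u ⟨hs.trans hu.1, hu.2.trans ht⟩)) γ.continuous_extend.continuousWithinAt
    have hi := hc.intervalIntegrable_of_Icc (μ := volume) hst.le
    refine hi.congr_ae ?_
    rw [uIoc_of_le hst.le, ← restrict_Ioo_eq_restrict_Ioc]
    filter_upwards [ae_restrict_mem measurableSet_Ioo] with u hu
    have hu' : u ∈ Ioo (0 : ℝ) 1 := ⟨hs.trans_lt hu.1, hu.2.trans_le ht⟩
    rw [curveIntegralFun_def, hω _ (hmem u ⟨hu'.1, hu'.2.le⟩),
      derivWithin_of_mem_nhds (Icc_mem_nhds hu.1 hu.2),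
      derivWithin_of_mem_nhds (Icc_mem_nhds hu'.1 hu'.2)]
  refine ⟨hint, ?_⟩
  rw [curveIntegral_def]
  -- The break points serve as the exceptional set of the fundamental theorem of calculus; `F ∘ γ`
  -- is continuous across them.
  have key := integral_eq_of_hasDerivAt_off_countable_of_le
    (fun u => F (γ.extend u)) (curveIntegralFun ω γ) (zero_le_one' ℝ)
    P.countable_toSet (hF.comp γ.continuous_extend).continuousOn ?_ hint
  · simpa using key
  · intro u ⟨hu, huP⟩
    have hdiff : HasDerivAt γ.extend (derivWithin γ.extend (Icc 0 1) u) u := by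
      have hnhds : Ioo (0 : ℝ) 1 ∩ (↑P : Set ℝ)ᶜ ∈ 𝓝 u :=
        inter_mem (Ioo_mem_nhds hu.1 hu.2) (P.finite_toSet.isClosed.isOpen_compl.mem_nhds huP)
      obtain ⟨ε, hε, hball⟩ := Metric.nhds_basis_closedBall.mem_iff.1 hnhds
      rw [Real.closedBall_eq_Icc] at hball
      have hl := hball (left_mem_Icc.2 (by linarith))
      have hr := hball (right_mem_Icc.2 (by linarith))
      have hC := hP (u - ε) (u + ε) hl.1.1.le (by linarith) hr.1.2.le
        fun p hp hp' => (hball (Ioo_subset_Icc_self hp')).2 hp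
      have hd : DifferentiableAt ℝ γ.extend u :=
        (hC.differentiableOn one_ne_zero).differentiableAt
          (Icc_mem_nhds (by linarith) (by linarith))
      rw [derivWithin_of_mem_nhds (Icc_mem_nhds hu.1 hu.2)]
      exact hd.hasDerivAt
    rw [curveIntegralFun_def]
    exact (hFω _ (hmem u ⟨hu.1, hu.2.le⟩)).comp_hasDerivAt u hdiff

theorem isPiecewiseC1_segment (a b : Fin 3 → ℝ) : IsPiecewiseC1 (Path.segment a b) := by
  refine ⟨∅, fun s t hs hst ht _ => ?_⟩
  have h : ContDiffOn ℝ 1 (fun u : ℝ => AffineMap.lineMap a b u) (Icc s t) := by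
    simp only [AffineMap.lineMap_apply_module']
    fun_prop
  refine h.congr fun u hu => ?_
  rw [Path.extend_apply _ ⟨hs.trans hu.1, hu.2.trans ht⟩]
  simp

theorem segment_apply (a b : Fin 3 → ℝ) (t : unitInterval) (i : Fin 3) :
    Path.segment a b t i = (1 - (t : ℝ)) * a i + t * b i := by
  simp [AffineMap.lineMap_apply_module]

/-! ### The potential and its derivative. -/

/-- The common potential of the two forms, up to a constant. -/
noncomputable def potential (x : Fin 3 → ℝ) : ℝ :=
  -(∑ i, lobachevsky (starAngle x i)) - lobachevsky ((π + x 0 + x 1 + x 2) / 2)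

theorem continuous_starAngle (i : Fin 3) : Continuous fun x => starAngle x i := by
  unfold starAngle; fun_prop

/-- Continuity holds on all of ℝ³, across the logarithmic singularities of the derivative; this is
what extends both capacities to the closures. -/
theorem continuous_potential : Continuous potential := by
  unfold potential
  have := continuous_lobachevsky
  have := continuous_starAngle
  fun_prop

/-- `ln |sin x*_i sin σ / (sin x*_j sin x*_k)| / 2`, with `σ = (π + x₁ + x₂ + x₃) / 2`: the
`i`-th partial derivative of the potential. -/
noncomputable def logRatio (x : Fin 3 → ℝ) (i : Fin 3) : ℝ :=
  (Real.log (Real.sin (starAngle x i)) + Real.log (Real.sin ((π + x 0 + x 1 + x 2) / 2)) -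
    Real.log (Real.sin (starAngle x (i + 1))) - Real.log (Real.sin (starAngle x (i + 2)))) / 2

noncomputable def logRatioForm (x : Fin 3 → ℝ) : (Fin 3 → ℝ) →L[ℝ] ℝ :=
  ∑ i, logRatio x i • ContinuousLinearMap.proj i

theorem continuousAt_logRatioForm {x : Fin 3 → ℝ} (h : ∀ i, Real.sin (starAngle x i) ≠ 0)
    (h' : Real.sin ((π + x 0 + x 1 + x 2) / 2) ≠ 0) : ContinuousAt logRatioForm x := by
  unfold logRatioForm logRatio
  have h1 : ∀ i, ContinuousAt (fun x => Real.log (Real.sin (starAngle x i))) x := fun i =>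
    ContinuousAt.log (continuous_sin.comp (continuous_starAngle i)).continuousAt (h i)
  have h2 : ContinuousAt
      (fun x : Fin 3 → ℝ => Real.log (Real.sin ((π + x 0 + x 1 + x 2) / 2))) x :=
    ContinuousAt.log (by fun_prop) h'
  fun_prop

/-- In each partial derivative the terms ln 2 enter twice with each sign and cancel. As `Real.log`
ignores signs, one formula serves both signs of sin σ, hence both geometries. -/
theorem hasFDerivAt_potential {x : Fin 3 → ℝ} (h : ∀ i, Real.sin (starAngle x i) ≠ 0)
    (h' : Real.sin ((π + x 0 + x 1 + x 2) / 2) ≠ 0) :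
    HasFDerivAt potential (logRatioForm x) x := by
  have hp : ∀ i, HasFDerivAt (fun x : Fin 3 → ℝ => x i)
    (ContinuousLinearMap.proj i : (Fin 3 → ℝ) →L[ℝ] ℝ) x := fun i => hasFDerivAt_apply i x
  have hs : ∀ i, HasFDerivAt (fun x => lobachevsky (starAngle x i))
      ((-Real.log |2 * Real.sin (starAngle x i)|) • ((1 / 2 : ℝ) •
        ((ContinuousLinearMap.proj i : (Fin 3 → ℝ) →L[ℝ] ℝ) - ContinuousLinearMap.proj (i + 1) -
          ContinuousLinearMap.proj (i + 2)))) x := by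
    intro i
    refine HasDerivAt.comp_hasFDerivAt (h₂ := lobachevsky) (f := fun x => starAngle x i) x
      (hasDerivAt_lobachevsky (h i)) ?_
    have := (((hp i).const_add π).sub (hp (i + 1)) |>.sub (hp (i + 2))).const_smul (1 / 2 : ℝ)
    refine this.congr_of_eventuallyEq (Eventually.of_forall fun y => ?_)
    simp [starAngle]; ring
  have ht : HasFDerivAt (fun x : Fin 3 → ℝ => lobachevsky ((π + x 0 + x 1 + x 2) / 2))
      ((-Real.log |2 * Real.sin ((π + x 0 + x 1 + x 2) / 2)|) • ((1 / 2 : ℝ) •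
        ((ContinuousLinearMap.proj 0 : (Fin 3 → ℝ) →L[ℝ] ℝ) + ContinuousLinearMap.proj 1 +
          ContinuousLinearMap.proj 2))) x := by
    refine HasDerivAt.comp_hasFDerivAt (h₂ := lobachevsky)
      (f := fun x : Fin 3 → ℝ => (π + x 0 + x 1 + x 2) / 2) x (hasDerivAt_lobachevsky h') ?_
    have := (((hp 0).const_add π).add (hp 1) |>.add (hp 2)).const_smul (1 / 2 : ℝ)
    refine this.congr_of_eventuallyEq (Eventually.of_forall fun y => ?_)
    simp; ring
  have := (HasFDerivAt.fun_sum (u := Finset.univ) fun i _ => hs i).neg.sub ht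
  refine this.congr_fderiv ?_
  ext v
  simp only [Real.log_abs, Real.log_mul two_ne_zero (h _), Real.log_mul two_ne_zero h',
    logRatioForm, logRatio, Fin.sum_univ_three]
  simp [starAngle]
  ring

/-! ### Edge cosines as functions of the angles. -/

theorem sin_mul_sin_sub_cos_add (A B C : ℝ) :
    sin B * sin C - (cos A + cos B * cos C) =
      -(2 * sin ((π + A + B + C) / 2) * sin ((π + A - B - C) / 2)) := by
  have h := cos_add_cos A (B + C)
  rw [cos_add] at h
  rw [show (π + A + B + C) / 2 = (A + (B + C)) / 2 + π / 2 by ring,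
    show (π + A - B - C) / 2 = (A - (B + C)) / 2 + π / 2 by ring, sin_add_pi_div_two,
    sin_add_pi_div_two]
  linarith

theorem sin_mul_sin_add_cos_add (A B C : ℝ) :
    sin B * sin C + (cos A + cos B * cos C) =
      2 * sin ((π + B - C - A) / 2) * sin ((π + C - A - B) / 2) := by
  have h := cos_add_cos A (B - C)
  rw [cos_sub] at h
  rw [show (π + B - C - A) / 2 = π / 2 - (A - (B - C)) / 2 by ring,
    show (π + C - A - B) / 2 = π / 2 - (A + (B - C)) / 2 by ring, sin_pi_div_two_sub,
    sin_pi_div_two_sub]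
  linarith

theorem fin3_add_one_add_one (i : Fin 3) : i + 1 + 1 = i + 2 := by revert i; decide
theorem fin3_add_one_add_two (i : Fin 3) : i + 1 + 2 = i := by revert i; decide
theorem fin3_add_two_add_one (i : Fin 3) : i + 2 + 1 = i := by revert i; decide
theorem fin3_add_two_add_two (i : Fin 3) : i + 2 + 2 = i + 1 := by revert i; decide

theorem sum_rotate (x : Fin 3 → ℝ) (i : Fin 3) :
    x 0 + x 1 + x 2 = x i + x (i + 1) + x (i + 2) := by
  fin_cases i <;> simp <;> ring

theorem pi_add_sum_rotate (x : Fin 3 → ℝ) (i : Fin 3) :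
    π + x 0 + x 1 + x 2 = π + x i + x (i + 1) + x (i + 2) := by
  linarith [sum_rotate x i]

theorem trig_sub (x : Fin 3 → ℝ) (i : Fin 3) :
    sin (x (i + 1)) * sin (x (i + 2)) - (cos (x i) + cos (x (i + 1)) * cos (x (i + 2))) =
      -(2 * sin ((π + x 0 + x 1 + x 2) / 2) * sin (starAngle x i)) := by
  rw [pi_add_sum_rotate x i, starAngle, ← sin_mul_sin_sub_cos_add]

theorem trig_add (x : Fin 3 → ℝ) (i : Fin 3) :
    sin (x (i + 1)) * sin (x (i + 2)) + (cos (x i) + cos (x (i + 1)) * cos (x (i + 2))) =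
      2 * sin (starAngle x (i + 1)) * sin (starAngle x (i + 2)) := by
  rw [starAngle, starAngle, fin3_add_one_add_one, fin3_add_one_add_two, fin3_add_two_add_one,
    fin3_add_two_add_two, ← sin_mul_sin_add_cos_add]

/-- The cosine (or hyperbolic cosine) of the `i`-th edge of a triangle with angles `x`. -/
noncomputable def edgeCos (x : Fin 3 → ℝ) (i : Fin 3) : ℝ :=
  (cos (x i) + cos (x (i + 1)) * cos (x (i + 2))) / (sin (x (i + 1)) * sin (x (i + 2)))

theorem one_sub_edgeCos {x : Fin 3 → ℝ} (h : ∀ i, 0 < sin (x i)) (i : Fin 3) :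
    1 - edgeCos x i = -(2 * sin ((π + x 0 + x 1 + x 2) / 2) * sin (starAngle x i)) /
      (sin (x (i + 1)) * sin (x (i + 2))) := by
  rw [← trig_sub, edgeCos, sub_div, div_self (mul_pos (h _) (h _)).ne']

theorem one_add_edgeCos {x : Fin 3 → ℝ} (h : ∀ i, 0 < sin (x i)) (i : Fin 3) :
    1 + edgeCos x i = 2 * sin (starAngle x (i + 1)) * sin (starAngle x (i + 2)) /
      (sin (x (i + 1)) * sin (x (i + 2))) := by
  rw [← trig_add, edgeCos, add_div (sin _ * sin _), div_self (mul_pos (h _) (h _)).ne']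

/-- The Gram determinant of the cosines of the angles. -/
noncomputable def angleGram (x : Fin 3 → ℝ) : ℝ :=
  1 - cos (x 0) ^ 2 - cos (x 1) ^ 2 - cos (x 2) ^ 2 - 2 * cos (x 0) * cos (x 1) * cos (x 2)

theorem angleGram_rotate (x : Fin 3 → ℝ) (i : Fin 3) : angleGram x =
    1 - cos (x i) ^ 2 - cos (x (i + 1)) ^ 2 - cos (x (i + 2)) ^ 2 -
      2 * cos (x i) * cos (x (i + 1)) * cos (x (i + 2)) := by
  fin_cases i <;> simp [angleGram] <;> ring

theorem one_sub_edgeCos_sq {x : Fin 3 → ℝ} (h : ∀ i, 0 < sin (x i)) (i : Fin 3) :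
    1 - edgeCos x i ^ 2 = angleGram x / (sin (x (i + 1)) * sin (x (i + 2))) ^ 2 := by
  have := h (i + 1)
  have := h (i + 2)
  rw [edgeCos, angleGram_rotate x i, eq_div_iff (by positivity)]
  field_simp
  have h1 := sin_sq_add_cos_sq (x (i + 1))
  have h2 := sin_sq_add_cos_sq (x (i + 2))
  linear_combination (1 - cos (x (i + 2)) ^ 2) * h1 + sin (x (i + 1)) ^ 2 * h2

/-- Compare 1 - c² with (1 - c)(1 + c) for c = `edgeCos x 0`. With positive star sines, the sign is
opposite to that of sin σ and so separates the two geometries. -/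
theorem angleGram_eq {x : Fin 3 → ℝ} (h : ∀ i, 0 < sin (x i)) : angleGram x =
    -(4 * sin ((π + x 0 + x 1 + x 2) / 2) * sin (starAngle x 0) * sin (starAngle x 1) *
      sin (starAngle x 2)) := by
  have h0 := one_sub_edgeCos_sq h 0
  have h1 := one_sub_edgeCos h 0
  have h2 := one_add_edgeCos h 0
  have := h (0 + 1)
  have := h (0 + 2)
  rw [show 1 - edgeCos x 0 ^ 2 = (1 - edgeCos x 0) * (1 + edgeCos x 0) by ring, h1, h2,
    eq_div_iff (by positivity)] at h0
  field_simp at h0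
  simp only [zero_add] at h0
  rw [← h0]
  ring

/-- The law of cosines for the triangle with edge cosines `edgeCos x`. -/
theorem edgeCos_sub_mul {x : Fin 3 → ℝ} (h : ∀ i, 0 < sin (x i)) (i : Fin 3) :
    edgeCos x i - edgeCos x (i + 1) * edgeCos x (i + 2) = cos (x i) * angleGram x /
      (sin (x i) ^ 2 * sin (x (i + 1)) * sin (x (i + 2))) := by
  have := h i
  have := h (i + 1)
  have := h (i + 2)
  rw [edgeCos, edgeCos, edgeCos, angleGram_rotate x i, fin3_add_one_add_one,
    fin3_add_one_add_two, fin3_add_two_add_one, fin3_add_two_add_two]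
  rw [eq_div_iff (by positivity)]
  field_simp
  have h1 := sin_sq_add_cos_sq (x i)
  linear_combination
    (cos (x i) + cos (x (i + 1)) * cos (x (i + 2))) * h1

theorem sin_starAngle_pos {x : Fin 3 → ℝ} (h : ∀ i, 0 < x i ∧ x i < π)
    (hs : ∀ i, 0 < starAngle x i) (i : Fin 3) : 0 < sin (starAngle x i) := by
  refine sin_pos_of_pos_of_lt_pi (hs i) ?_
  have := h i
  have := h (i + 1)
  have := h (i + 2)
  unfold starAngle
  linarith

theorem sin_sum_neg {x : Fin 3 → ℝ} (hx : x ∈ sphericalDomain) :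
    sin ((π + x 0 + x 1 + x 2) / 2) < 0 := by
  obtain ⟨h, hS, -⟩ := hx
  rw [Fin.sum_univ_three] at hS
  rw [← neg_pos, ← sin_sub_pi]
  have := h 0
  have := h 1
  have := h 2
  exact sin_pos_of_pos_of_lt_pi (by linarith) (by linarith)

theorem sin_sum_pos {x : Fin 3 → ℝ} (hx : x ∈ hyperbolicDomain) :
    0 < sin ((π + x 0 + x 1 + x 2) / 2) := by
  obtain ⟨h, hS⟩ := hx
  rw [Fin.sum_univ_three] at hS
  have := h 0
  have := h 1
  have := h 2
  exact sin_pos_of_pos_of_lt_pi (by linarith [pi_pos]) (by linarith)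

theorem sin_starAngle_pos_of_spherical {x : Fin 3 → ℝ} (hx : x ∈ sphericalDomain) (i : Fin 3) :
    0 < sin (starAngle x i) :=
  sin_starAngle_pos hx.1 hx.2.2 i

theorem sin_starAngle_pos_of_hyperbolic {x : Fin 3 → ℝ} (hx : x ∈ hyperbolicDomain)
    (i : Fin 3) : 0 < sin (starAngle x i) := by
  refine sin_starAngle_pos hx.1 (fun i => ?_) i
  have h := hx.2
  rw [Fin.sum_univ_three, sum_rotate x i] at h
  have := hx.1 i
  unfold starAngle
  linarith

theorem sin_pos_of_spherical {x : Fin 3 → ℝ} (hx : x ∈ sphericalDomain) (i : Fin 3) :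
    0 < sin (x i) := sin_pos_of_pos_of_lt_pi (hx.1 i).1 (hx.1 i).2

theorem sin_pos_of_hyperbolic {x : Fin 3 → ℝ} (hx : x ∈ hyperbolicDomain) (i : Fin 3) :
    0 < sin (x i) := sin_pos_of_pos_of_lt_pi (hx.1 i).1 (hx.1 i).2

theorem angleGram_pos {x : Fin 3 → ℝ} (hx : x ∈ sphericalDomain) : 0 < angleGram x := by
  rw [angleGram_eq (sin_pos_of_spherical hx)]
  have h := sin_sum_neg hx
  have h0 := sin_starAngle_pos_of_spherical hx 0
  have h1 := sin_starAngle_pos_of_spherical hx 1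
  have h2 := sin_starAngle_pos_of_spherical hx 2
  have := mul_pos (mul_pos (mul_pos (neg_pos.2 h) h0) h1) h2
  linarith

theorem angleGram_neg {x : Fin 3 → ℝ} (hx : x ∈ hyperbolicDomain) : angleGram x < 0 := by
  rw [angleGram_eq (sin_pos_of_hyperbolic hx)]
  have h := sin_sum_pos hx
  have h0 := sin_starAngle_pos_of_hyperbolic hx 0
  have h1 := sin_starAngle_pos_of_hyperbolic hx 1
  have h2 := sin_starAngle_pos_of_hyperbolic hx 2
  have := mul_pos (mul_pos (mul_pos h h0) h1) h2
  linarith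

/-! ### Spherical triangles. -/

/-- The Gram determinant is (1 - a²)(1 - b²) - (c - ab)², which is not positive when a² = 1. -/
theorem sq_lt_one_of_gram {a b c : ℝ} (ha : a ^ 2 ≤ 1)
    (h : 0 < 1 - a ^ 2 - b ^ 2 - c ^ 2 + 2 * a * b * c) : a ^ 2 < 1 := by
  refine lt_of_le_of_ne ha fun h' => ?_
  nlinarith [sq_nonneg (c - a * b)]

namespace SphericalTriangle

variable (T : SphericalTriangle)

/-- The cosine of the edge facing the `i`-th vertex. -/
noncomputable def cosEdge (i : Fin 3) : ℝ := ⟪T.vertex (i + 1), T.vertex (i + 2)⟫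

/-- The matrix whose rows are the vertices. -/
noncomputable def mat : Matrix (Fin 3) (Fin 3) ℝ := Matrix.of fun i j => T.vertex i j

noncomputable def gram : ℝ :=
  1 - T.cosEdge 0 ^ 2 - T.cosEdge 1 ^ 2 - T.cosEdge 2 ^ 2 +
    2 * T.cosEdge 0 * T.cosEdge 1 * T.cosEdge 2

theorem inner_self (i : Fin 3) : ⟪T.vertex i, T.vertex i⟫ = 1 := by
  rw [real_inner_self_eq_norm_sq, T.norm_vertex]; norm_num

theorem inner_add_one (i : Fin 3) : ⟪T.vertex i, T.vertex (i + 1)⟫ = T.cosEdge (i + 2) := by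
  rw [cosEdge, fin3_add_two_add_one, fin3_add_two_add_two]

theorem inner_add_two (i : Fin 3) : ⟪T.vertex i, T.vertex (i + 2)⟫ = T.cosEdge (i + 1) := by
  rw [cosEdge, fin3_add_one_add_one, fin3_add_one_add_two, real_inner_comm]

theorem cos_edge (i : Fin 3) : cos (T.edge i) = T.cosEdge i := by
  rw [edge, InnerProductGeometry.cos_angle, T.norm_vertex, T.norm_vertex, mul_one, div_one,
    cosEdge]

theorem det_mat_ne_zero : T.mat.det ≠ 0 := by
  have h : LinearIndependent ℝ T.mat.row := by
    have := T.linearIndependent.map' (WithLp.linearEquiv 2 ℝ (Fin 3 → ℝ)).toLinearMap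
      (LinearEquiv.ker _)
    exact this
  exact ((Matrix.isUnit_iff_isUnit_det _).1 (Matrix.linearIndependent_rows_iff_isUnit.1 h)).ne_zero

theorem det_mat_sq : T.mat.det ^ 2 = T.gram := by
  have key : T.mat.det ^ 2 = ⟪T.vertex 0, T.vertex 0⟫ * ⟪T.vertex 1, T.vertex 1⟫ *
      ⟪T.vertex 2, T.vertex 2⟫ - ⟪T.vertex 0, T.vertex 0⟫ * T.cosEdge 0 ^ 2 -
      ⟪T.vertex 1, T.vertex 1⟫ * T.cosEdge 1 ^ 2 - ⟪T.vertex 2, T.vertex 2⟫ * T.cosEdge 2 ^ 2 +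
      2 * T.cosEdge 0 * T.cosEdge 1 * T.cosEdge 2 := by
    simp only [cosEdge, PiLp.inner_apply, Fin.sum_univ_three, Matrix.det_fin_three, mat,
      Matrix.of_apply, RCLike.inner_apply, conj_trivial, Fin.isValue, zero_add, Fin.reduceAdd]
    ring
  rw [key, T.inner_self, T.inner_self, T.inner_self, gram]
  ring

theorem gram_pos : 0 < T.gram := by
  rw [← det_mat_sq]
  have := T.det_mat_ne_zero
  positivity

theorem gram_rotate (i : Fin 3) : T.gram =
    1 - T.cosEdge i ^ 2 - T.cosEdge (i + 1) ^ 2 - T.cosEdge (i + 2) ^ 2 +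
      2 * T.cosEdge i * T.cosEdge (i + 1) * T.cosEdge (i + 2) := by
  fin_cases i <;> simp [gram] <;> ring

theorem cosEdge_sq_lt_one (i : Fin 3) : T.cosEdge i ^ 2 < 1 := by
  have h : ∀ i, T.cosEdge i ^ 2 ≤ 1 := fun i => by
    rw [← cos_edge]; exact cos_sq_le_one _
  have hg := T.gram_pos
  rw [T.gram_rotate i] at hg
  exact sq_lt_one_of_gram (h i) hg

theorem sinEdge_pos (i : Fin 3) : 0 < √(1 - T.cosEdge i ^ 2) :=
  sqrt_pos.2 (sub_pos.2 (T.cosEdge_sq_lt_one i))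

theorem sinEdge_sq (i : Fin 3) : √(1 - T.cosEdge i ^ 2) ^ 2 = 1 - T.cosEdge i ^ 2 :=
  sq_sqrt (sub_nonneg.2 (T.cosEdge_sq_lt_one i).le)

theorem cos_innerAngle (i : Fin 3) : cos (T.innerAngle i) =
    (T.cosEdge i - T.cosEdge (i + 1) * T.cosEdge (i + 2)) /
      (√(1 - T.cosEdge (i + 1) ^ 2) * √(1 - T.cosEdge (i + 2) ^ 2)) := by
  have hn1 : ‖T.tangent i (i + 1)‖ = √(1 - T.cosEdge (i + 2) ^ 2) := by
    rw [norm_eq_sqrt_real_inner, tangent, T.inner_add_one]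
    congr 1
    simp only [inner_sub_left, inner_sub_right, inner_smul_left, inner_smul_right,
      T.inner_self, T.inner_add_one, real_inner_comm (T.vertex i) (T.vertex (i + 1)),
      conj_trivial]
    ring
  have hn2 : ‖T.tangent i (i + 2)‖ = √(1 - T.cosEdge (i + 1) ^ 2) := by
    rw [norm_eq_sqrt_real_inner, tangent, T.inner_add_two]
    congr 1
    simp only [inner_sub_left, inner_sub_right, inner_smul_left, inner_smul_right,
      T.inner_self, T.inner_add_two, real_inner_comm (T.vertex i) (T.vertex (i + 2)),
      conj_trivial]
    ring
  have hi : ⟪T.tangent i (i + 1), T.tangent i (i + 2)⟫ =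
      T.cosEdge i - T.cosEdge (i + 1) * T.cosEdge (i + 2) := by
    rw [tangent, tangent, T.inner_add_one, T.inner_add_two]
    simp only [inner_sub_left, inner_sub_right, inner_smul_left, inner_smul_right,
      T.inner_self, T.inner_add_two, T.inner_add_one, real_inner_comm (T.vertex i) (T.vertex (i + 1)),
      conj_trivial]
    rw [show ⟪T.vertex (i + 1), T.vertex (i + 2)⟫ = T.cosEdge i from rfl]
    ring
  rw [innerAngle, InnerProductGeometry.cos_angle, hn1, hn2, hi, mul_comm (√_)]

theorem sin_innerAngle (i : Fin 3) : sin (T.innerAngle i) =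
    √T.gram / (√(1 - T.cosEdge (i + 1) ^ 2) * √(1 - T.cosEdge (i + 2) ^ 2)) := by
  have h1 := T.sinEdge_pos (i + 1)
  have h2 := T.sinEdge_pos (i + 2)
  have h1' := T.sinEdge_sq (i + 1)
  have h2' := T.sinEdge_sq (i + 2)
  have hs : 0 ≤ sin (T.innerAngle i) := InnerProductGeometry.sin_angle_nonneg _ _
  rw [← sq_eq_sq₀ hs (by positivity), sin_sq, cos_innerAngle, div_pow, div_pow,
    sq_sqrt T.gram_pos.le, mul_pow, h1', h2', T.gram_rotate i]
  have h3 : 0 < 1 - T.cosEdge (i + 1) ^ 2 := by rw [← h1']; positivity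
  have h4 : 0 < 1 - T.cosEdge (i + 2) ^ 2 := by rw [← h2']; positivity
  field_simp
  ring

theorem sin_innerAngle_pos (i : Fin 3) : 0 < sin (T.innerAngle i) := by
  rw [sin_innerAngle]
  exact div_pos (sqrt_pos.2 T.gram_pos) (mul_pos (T.sinEdge_pos _) (T.sinEdge_pos _))

theorem innerAngle_mem (i : Fin 3) : 0 < T.innerAngle i ∧ T.innerAngle i < π := by
  have h := T.sin_innerAngle_pos i
  have h0 : 0 ≤ T.innerAngle i := InnerProductGeometry.angle_nonneg _ _
  have h1 : T.innerAngle i ≤ π := InnerProductGeometry.angle_le_pi _ _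
  refine ⟨h0.lt_of_ne fun h' => ?_, h1.lt_of_ne fun h' => ?_⟩
  · rw [← h', sin_zero] at h; exact h.false
  · rw [h', sin_pi] at h; exact h.false

/-- The second law of cosines. -/
theorem cosEdge_eq_edgeCos (i : Fin 3) : T.cosEdge i = edgeCos T.innerAngle i := by
  have := T.sin_innerAngle_pos (i + 1)
  have := T.sin_innerAngle_pos (i + 2)
  rw [edgeCos, eq_div_iff (by positivity), sin_innerAngle, sin_innerAngle, cos_innerAngle,
    cos_innerAngle, cos_innerAngle, fin3_add_one_add_one,
    fin3_add_one_add_two, fin3_add_two_add_one, fin3_add_two_add_two]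
  have h0 := T.sinEdge_pos i
  have h1 := T.sinEdge_pos (i + 1)
  have h2 := T.sinEdge_pos (i + 2)
  have h0' := T.sinEdge_sq i
  have hg := sq_sqrt T.gram_pos.le
  have hg' := T.gram_rotate i
  generalize √T.gram = g at *
  generalize √(1 - T.cosEdge i ^ 2) = s0 at *
  generalize √(1 - T.cosEdge (i + 1) ^ 2) = s1 at *
  generalize √(1 - T.cosEdge (i + 2) ^ 2) = s2 at *
  field_simp
  rw [hg, h0', hg']
  ring

theorem innerAngle_mem_sphericalDomain : T.innerAngle ∈ sphericalDomain := by
  have hm := T.innerAngle_mem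
  have hs := T.sin_innerAngle_pos
  -- An edge cosine below 1 means cos xᵢ < cos(π - xⱼ - xₖ). The two signs of the absolute value
  -- yield the conditions on the angle sum and on `starAngle`.
  have h1 : ∀ i, |π - T.innerAngle (i + 1) - T.innerAngle (i + 2)| < T.innerAngle i := by
    intro i
    have a0 := hm i
    have a1 := hm (i + 1)
    have a2 := hm (i + 2)
    have s1 := hs (i + 1)
    have s2 := hs (i + 2)
    by_contra! hcon
    have hc := cos_le_cos_of_nonneg_of_le_pi a0.1.le (abs_le.2 ⟨by linarith, by linarith⟩) hcon
    rw [cos_abs, sub_sub, cos_pi_sub, cos_add] at hc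
    have hlt := T.cosEdge_sq_lt_one i
    rw [T.cosEdge_eq_edgeCos] at hlt
    have h : edgeCos T.innerAngle i < 1 := lt_of_abs_lt ((sq_lt_one_iff_abs_lt_one _).1 hlt)
    rw [edgeCos, div_lt_one (by positivity)] at h
    linarith
  refine ⟨hm, ?_, fun i => ?_⟩
  · rw [Fin.sum_univ_three]
    have := (abs_lt.1 (h1 0)).2
    simp only [zero_add] at this
    linarith
  · have := (abs_lt.1 (h1 i)).1
    unfold starAngle
    linarith

theorem edge_mem (i : Fin 3) : 0 < T.edge i ∧ T.edge i < π := by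
  have h := T.cosEdge_sq_lt_one i
  rw [← cos_edge] at h
  have h0 : 0 ≤ T.edge i := InnerProductGeometry.angle_nonneg _ _
  have h1 : T.edge i ≤ π := InnerProductGeometry.angle_le_pi _ _
  refine ⟨h0.lt_of_ne fun h' => ?_, h1.lt_of_ne fun h' => ?_⟩
  · rw [← h', cos_zero] at h; norm_num at h
  · rw [h', cos_pi] at h; norm_num at h

theorem edge_eq_arccos (i : Fin 3) : T.edge i = arccos (edgeCos T.innerAngle i) := by
  rw [← T.cosEdge_eq_edgeCos, ← T.cos_edge, arccos_cos (T.edge_mem i).1.le (T.edge_mem i).2.le]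

theorem exists_innerAngle_eq {x : Fin 3 → ℝ} (hx : x ∈ sphericalDomain) :
    ∃ T : SphericalTriangle, T.innerAngle = x := by
  have hs := sin_pos_of_spherical hx
  have hG := angleGram_pos hx
  have hc := one_sub_edgeCos_sq hs
  have hlaw := edgeCos_sub_mul hs
  have hpos : ∀ i, 0 < 1 - edgeCos x i ^ 2 := fun i => by
    rw [hc]; exact div_pos hG (pow_pos (mul_pos (hs _) (hs _)) 2)
  have hsq : ∀ i, √(1 - edgeCos x i ^ 2) ^ 2 = 1 - edgeCos x i ^ 2 := fun i =>
    sq_sqrt (hpos i).le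
  have hcos : ∀ i, edgeCos x i - edgeCos x (i + 1) * edgeCos x (i + 2) =
      √(1 - edgeCos x (i + 1) ^ 2) * √(1 - edgeCos x (i + 2) ^ 2) * cos (x i) := by
    intro i
    have := hs i
    have := hs (i + 1)
    have := hs (i + 2)
    rw [hlaw, hc (i + 1), hc (i + 2), sqrt_div hG.le, sqrt_div hG.le, fin3_add_one_add_one,
      fin3_add_one_add_two, fin3_add_two_add_one, fin3_add_two_add_two,
      sqrt_sq (by positivity), sqrt_sq (by positivity)]
    have hg := sq_sqrt hG.le
    field_simp
    rw [hg]
  have hG0 : ∀ i, 0 < √(1 - edgeCos x i ^ 2) := fun i => sqrt_pos.2 (hpos i)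
  -- Vertex 0 is a pole, from which edges of cosines `edgeCos x 2` and `edgeCos x 1` leave at angle
  -- `x 0`. By the law of cosines `hcos` the third edge is then right as well.
  let v : Fin 3 → E3 := ![!₂[1, 0, 0], !₂[edgeCos x 2, √(1 - edgeCos x 2 ^ 2), 0],
    !₂[edgeCos x 1, √(1 - edgeCos x 1 ^ 2) * cos (x 0), √(1 - edgeCos x 1 ^ 2) * sin (x 0)]]
  have hdet : (Matrix.of fun i j => v i j).det ≠ 0 := by
    have := hG0 1
    have := hG0 2
    have := hs 0
    simp only [Matrix.det_fin_three, Matrix.of_apply]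
    simp [v]
    refine ⟨by positivity, by positivity, by positivity⟩
  have hli : LinearIndependent ℝ v := by
    have h := Matrix.linearIndependent_rows_iff_isUnit.2
      ((Matrix.isUnit_iff_isUnit_det _).2 hdet.isUnit)
    exact h.map' (WithLp.linearEquiv 2 ℝ (Fin 3 → ℝ)).symm.toLinearMap (LinearEquiv.ker _)
  have hnorm : ∀ i, ‖v i‖ = 1 := by
    intro i
    rw [EuclideanSpace.norm_eq, sqrt_eq_one, Fin.sum_univ_three]
    have h1 := hsq 1
    have h2 := hsq 2
    have h3 := sin_sq_add_cos_sq (x 0)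
    fin_cases i
    · simp [v]
    · simp [v, h2]
    · simp [v, mul_pow, h1]
      linear_combination (1 - edgeCos x 1 ^ 2) * h3
  let T : SphericalTriangle := ⟨v, hnorm, hli⟩
  have hT : ∀ i, T.cosEdge i = edgeCos x i := by
    intro i
    have h := hcos 0
    simp only [zero_add] at h
    fin_cases i
    · simp [cosEdge, T, v, PiLp.inner_apply, Fin.sum_univ_three]
      linarith
    · simp [cosEdge, T, v, PiLp.inner_apply, Fin.sum_univ_three]
    · simp [cosEdge, T, v, PiLp.inner_apply, Fin.sum_univ_three]
  refine ⟨T, funext fun i => ?_⟩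
  refine injOn_cos ⟨(T.innerAngle_mem i).1.le, (T.innerAngle_mem i).2.le⟩
    ⟨(hx.1 i).1.le, (hx.1 i).2.le⟩ ?_
  rw [T.cos_innerAngle, hT, hT, hT, hcos]
  have := hG0 (i + 1)
  have := hG0 (i + 2)
  field_simp

theorem range_innerAngle : range innerAngle = sphericalDomain := by
  ext x
  exact ⟨fun ⟨T, hT⟩ => hT ▸ T.innerAngle_mem_sphericalDomain, exists_innerAngle_eq⟩

/-- By the second law of cosines all triangles with the given angles have the same edges, so the
choice made by `Classical.epsilon` is immaterial. -/
theorem edge_eq_sphericalEdge : T.edge = sphericalEdge T.innerAngle := by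
  obtain ⟨T', hT', hy⟩ := Classical.epsilon_spec
    (p := fun y => ∃ T' : SphericalTriangle, T'.innerAngle = T.innerAngle ∧ T'.edge = y)
    ⟨T.edge, T, rfl, rfl⟩
  rw [sphericalEdge, ← hy]
  funext i
  rw [T.edge_eq_arccos, T'.edge_eq_arccos, hT']

end SphericalTriangle

/-! ### The spherical form in terms of the angles. -/

theorem tan_half_eq {y : ℝ} (h0 : 0 < y) (h1 : y < π) :
    log (tan (y / 2)) = (log (1 - cos y) - log (1 + cos y)) / 2 := by
  have hs : 0 < sin (y / 2) := sin_pos_of_pos_of_lt_pi (by linarith) (by linarith)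
  have hc : 0 < cos (y / 2) := cos_pos_of_mem_Ioo ⟨by linarith, by linarith⟩
  have h : cos y = 2 * cos (y / 2) ^ 2 - 1 := by rw [← cos_two_mul]; ring_nf
  have h' : 1 - cos y = 2 * sin (y / 2) ^ 2 := by rw [h, cos_sq']; ring
  rw [h', h, tan_eq_sin_div_cos, log_div hs.ne' hc.ne', log_mul two_ne_zero (by positivity),
    show 1 + (2 * cos (y / 2) ^ 2 - 1) = 2 * cos (y / 2) ^ 2 by ring,
    log_mul two_ne_zero (by positivity), log_pow, log_pow]
  push_cast
  ring

theorem log_edge_ratio {x : Fin 3 → ℝ} (h : ∀ i, 0 < sin (x i))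
    (hs : ∀ i, 0 < sin (starAngle x i)) (h' : sin ((π + x 0 + x 1 + x 2) / 2) ≠ 0) (i : Fin 3) :
    (log (1 - edgeCos x i) - log (1 + edgeCos x i)) / 2 = logRatio x i := by
  have := (hs i).ne'
  have := (hs (i + 1)).ne'
  have := (hs (i + 2)).ne'
  have := (h (i + 1)).ne'
  have := (h (i + 2)).ne'
  rw [one_sub_edgeCos h, one_add_edgeCos h, log_div (by simp [*]) (by positivity),
    log_div (by positivity) (by positivity), log_neg_eq_log, log_mul (by positivity) (by positivity),
    log_mul (by positivity) (by positivity), log_mul (by positivity) (by positivity),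
    log_mul (by positivity) (by positivity), log_mul two_ne_zero (by positivity), logRatio]
  ring

theorem sphericalForm_eq {x : Fin 3 → ℝ} (hx : x ∈ sphericalDomain) :
    sphericalForm x = logRatioForm x := by
  obtain ⟨T, rfl⟩ := SphericalTriangle.exists_innerAngle_eq hx
  unfold sphericalForm logRatioForm
  refine Finset.sum_congr rfl fun i _ => ?_
  rw [← T.edge_eq_sphericalEdge, tan_half_eq (T.edge_mem i).1 (T.edge_mem i).2, T.cos_edge,
    T.cosEdge_eq_edgeCos, log_edge_ratio (sin_pos_of_spherical hx)
      (sin_starAngle_pos_of_spherical hx) (sin_sum_neg hx).ne]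

/-! ### Hyperbolic triangles and the hyperbolic form. -/

theorem lorentz_comm (v w : Fin 3 → ℝ) : lorentz v w = lorentz w v := by
  unfold lorentz; ring

theorem lorentz_add_left (u v w : Fin 3 → ℝ) :
    lorentz (u + v) w = lorentz u w + lorentz v w := by
  simp only [lorentz, Pi.add_apply]; ring

theorem lorentz_add_right (u v w : Fin 3 → ℝ) :
    lorentz u (v + w) = lorentz u v + lorentz u w := by
  simp only [lorentz, Pi.add_apply]; ring

theorem lorentz_smul_left (a : ℝ) (v w : Fin 3 → ℝ) :
    lorentz (a • v) w = a * lorentz v w := by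
  simp only [lorentz, Pi.smul_apply, smul_eq_mul]; ring

theorem lorentz_smul_right (a : ℝ) (v w : Fin 3 → ℝ) :
    lorentz v (a • w) = a * lorentz v w := by
  simp only [lorentz, Pi.smul_apply, smul_eq_mul]; ring

/-- Cauchy–Schwarz for (1, v₀, v₁) and (1, w₀, w₁), whose norms are v₂ and w₂. -/
theorem one_le_neg_lorentz {v w : Fin 3 → ℝ} (hv : lorentz v v = -1) (hw : lorentz w w = -1)
    (hv0 : 0 < v 2) (hw0 : 0 < w 2) : 1 ≤ -lorentz v w := by
  have h : (1 + v 0 * w 0 + v 1 * w 1) ^ 2 ≤ (v 2 * w 2) ^ 2 := by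
    have h1 : v 2 ^ 2 = 1 + v 0 ^ 2 + v 1 ^ 2 := by simp only [lorentz] at hv; linarith
    have h2 : w 2 ^ 2 = 1 + w 0 ^ 2 + w 1 ^ 2 := by simp only [lorentz] at hw; linarith
    rw [mul_pow, h1, h2]
    nlinarith [sq_nonneg (v 0 - w 0), sq_nonneg (v 1 - w 1), sq_nonneg (v 0 * w 1 - v 1 * w 0)]
  have := le_of_abs_le (abs_le_of_sq_le_sq h (mul_pos hv0 hw0).le)
  unfold lorentz
  linarith

namespace HyperbolicTriangle

variable (T : HyperbolicTriangle)

/-- The hyperbolic cosine of the edge facing the `i`-th vertex. -/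
def coshEdge (i : Fin 3) : ℝ := -lorentz (T.vertex (i + 1)) (T.vertex (i + 2))

def gram : ℝ :=
  1 - T.coshEdge 0 ^ 2 - T.coshEdge 1 ^ 2 - T.coshEdge 2 ^ 2 +
    2 * T.coshEdge 0 * T.coshEdge 1 * T.coshEdge 2

theorem lorentz_add_one (i : Fin 3) :
    lorentz (T.vertex i) (T.vertex (i + 1)) = -T.coshEdge (i + 2) := by
  rw [coshEdge, fin3_add_two_add_one, fin3_add_two_add_two, neg_neg]

theorem lorentz_add_two (i : Fin 3) :
    lorentz (T.vertex i) (T.vertex (i + 2)) = -T.coshEdge (i + 1) := by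
  rw [coshEdge, fin3_add_one_add_one, fin3_add_one_add_two, lorentz_comm, neg_neg]

theorem det_mat_ne_zero : (Matrix.of T.vertex).det ≠ 0 :=
  ((Matrix.isUnit_iff_isUnit_det _).1
    (Matrix.linearIndependent_rows_iff_isUnit.1 T.linearIndependent)).ne_zero

theorem det_mat_sq : (Matrix.of T.vertex).det ^ 2 = T.gram := by
  have key : (Matrix.of T.vertex).det ^ 2 =
      -(lorentz (T.vertex 0) (T.vertex 0) * lorentz (T.vertex 1) (T.vertex 1) *
        lorentz (T.vertex 2) (T.vertex 2)) +
      lorentz (T.vertex 0) (T.vertex 0) * T.coshEdge 0 ^ 2 +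
      lorentz (T.vertex 1) (T.vertex 1) * T.coshEdge 1 ^ 2 +
      lorentz (T.vertex 2) (T.vertex 2) * T.coshEdge 2 ^ 2 +
      2 * T.coshEdge 0 * T.coshEdge 1 * T.coshEdge 2 := by
    simp only [coshEdge, lorentz, Matrix.det_fin_three, Matrix.of_apply, Fin.isValue, zero_add,
      Fin.reduceAdd]
    ring
  rw [key, T.lorentz_vertex, T.lorentz_vertex, T.lorentz_vertex, gram]
  ring

theorem gram_pos : 0 < T.gram := by
  rw [← det_mat_sq]
  have := T.det_mat_ne_zero
  positivity

theorem gram_rotate (i : Fin 3) : T.gram =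
    1 - T.coshEdge i ^ 2 - T.coshEdge (i + 1) ^ 2 - T.coshEdge (i + 2) ^ 2 +
      2 * T.coshEdge i * T.coshEdge (i + 1) * T.coshEdge (i + 2) := by
  fin_cases i <;> simp [gram] <;> ring

theorem one_lt_coshEdge (i : Fin 3) : 1 < T.coshEdge i := by
  have h : 1 ≤ T.coshEdge i :=
    one_le_neg_lorentz (T.lorentz_vertex _) (T.lorentz_vertex _) (T.vertex_pos _) (T.vertex_pos _)
  refine h.lt_of_ne' fun h' => ?_
  have hg := T.gram_pos
  rw [T.gram_rotate i, h'] at hg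
  nlinarith [sq_nonneg (T.coshEdge (i + 1) - T.coshEdge (i + 2))]

theorem coshEdge_sq_sub_one_pos (i : Fin 3) : 0 < T.coshEdge i ^ 2 - 1 := by
  nlinarith [T.one_lt_coshEdge i]

theorem cosh_edge (i : Fin 3) : cosh (T.edge i) = T.coshEdge i :=
  cosh_arcosh (T.one_lt_coshEdge i).le

theorem edge_pos (i : Fin 3) : 0 < T.edge i := arcosh_pos (T.one_lt_coshEdge i)

theorem sinhEdge_pos (i : Fin 3) : 0 < √(T.coshEdge i ^ 2 - 1) :=
  sqrt_pos.2 (T.coshEdge_sq_sub_one_pos i)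

theorem sinhEdge_sq (i : Fin 3) : √(T.coshEdge i ^ 2 - 1) ^ 2 = T.coshEdge i ^ 2 - 1 :=
  sq_sqrt (T.coshEdge_sq_sub_one_pos i).le

theorem innerAngle_eq_arccos (i : Fin 3) : T.innerAngle i =
    arccos ((T.coshEdge (i + 1) * T.coshEdge (i + 2) - T.coshEdge i) /
      (√(T.coshEdge (i + 1) ^ 2 - 1) * √(T.coshEdge (i + 2) ^ 2 - 1))) := by
  have h12 : lorentz (T.vertex (i + 1)) (T.vertex (i + 2)) = -T.coshEdge i := by
    rw [coshEdge, neg_neg]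
  have hn1 : lorentz (T.tangent i (i + 1)) (T.tangent i (i + 1)) = T.coshEdge (i + 2) ^ 2 - 1 := by
    simp only [tangent, lorentz_add_left, lorentz_add_right, lorentz_smul_left,
      lorentz_smul_right, T.lorentz_vertex, T.lorentz_add_one,
      lorentz_comm (T.vertex (i + 1)) (T.vertex i)]
    ring
  have hn2 : lorentz (T.tangent i (i + 2)) (T.tangent i (i + 2)) = T.coshEdge (i + 1) ^ 2 - 1 := by
    simp only [tangent, lorentz_add_left, lorentz_add_right, lorentz_smul_left,
      lorentz_smul_right, T.lorentz_vertex, T.lorentz_add_two,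
      lorentz_comm (T.vertex (i + 2)) (T.vertex i)]
    ring
  have hi : lorentz (T.tangent i (i + 1)) (T.tangent i (i + 2)) =
      T.coshEdge (i + 1) * T.coshEdge (i + 2) - T.coshEdge i := by
    simp only [tangent, lorentz_add_left, lorentz_add_right, lorentz_smul_left,
      lorentz_smul_right, T.lorentz_vertex, T.lorentz_add_two, T.lorentz_add_one, h12,
      lorentz_comm (T.vertex (i + 1)) (T.vertex i)]
    ring
  rw [innerAngle, hn1, hn2, hi, mul_comm (√_)]

theorem cos_innerAngle (i : Fin 3) : cos (T.innerAngle i) =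
    (T.coshEdge (i + 1) * T.coshEdge (i + 2) - T.coshEdge i) /
      (√(T.coshEdge (i + 1) ^ 2 - 1) * √(T.coshEdge (i + 2) ^ 2 - 1)) := by
  have h1 := T.sinhEdge_pos (i + 1)
  have h2 := T.sinhEdge_pos (i + 2)
  have h : ((T.coshEdge (i + 1) * T.coshEdge (i + 2) - T.coshEdge i) /
      (√(T.coshEdge (i + 1) ^ 2 - 1) * √(T.coshEdge (i + 2) ^ 2 - 1))) ^ 2 ≤ 1 := by
    rw [div_pow, div_le_one (by positivity), mul_pow, T.sinhEdge_sq, T.sinhEdge_sq]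
    have := T.gram_pos
    rw [T.gram_rotate i] at this
    linarith
  rw [innerAngle_eq_arccos]
  have h' := abs_le.1 ((sq_le_one_iff_abs_le_one _).1 h)
  exact cos_arccos h'.1 h'.2

theorem sin_innerAngle (i : Fin 3) : sin (T.innerAngle i) =
    √T.gram / (√(T.coshEdge (i + 1) ^ 2 - 1) * √(T.coshEdge (i + 2) ^ 2 - 1)) := by
  have h1 := T.sinhEdge_pos (i + 1)
  have h2 := T.sinhEdge_pos (i + 2)
  have h1' := T.sinhEdge_sq (i + 1)
  have h2' := T.sinhEdge_sq (i + 2)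
  have hs : 0 ≤ sin (T.innerAngle i) := sin_nonneg_of_nonneg_of_le_pi (arccos_nonneg _)
    (arccos_le_pi _)
  have h3 := T.coshEdge_sq_sub_one_pos (i + 1)
  have h4 := T.coshEdge_sq_sub_one_pos (i + 2)
  rw [← sq_eq_sq₀ hs (by positivity), sin_sq, cos_innerAngle, div_pow, div_pow,
    sq_sqrt T.gram_pos.le, mul_pow, h1', h2', T.gram_rotate i]
  field_simp
  ring

theorem sin_innerAngle_pos (i : Fin 3) : 0 < sin (T.innerAngle i) := by
  rw [sin_innerAngle]
  exact div_pos (sqrt_pos.2 T.gram_pos) (mul_pos (T.sinhEdge_pos _) (T.sinhEdge_pos _))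

theorem innerAngle_mem (i : Fin 3) : 0 < T.innerAngle i ∧ T.innerAngle i < π := by
  have h := T.sin_innerAngle_pos i
  have h0 : 0 ≤ T.innerAngle i := arccos_nonneg _
  have h1 : T.innerAngle i ≤ π := arccos_le_pi _
  refine ⟨h0.lt_of_ne fun h' => ?_, h1.lt_of_ne fun h' => ?_⟩
  · rw [← h', sin_zero] at h; exact h.false
  · rw [h', sin_pi] at h; exact h.false

/-- The second law of cosines. -/
theorem coshEdge_eq_edgeCos (i : Fin 3) : T.coshEdge i = edgeCos T.innerAngle i := by
  have := T.sin_innerAngle_pos (i + 1)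
  have := T.sin_innerAngle_pos (i + 2)
  rw [edgeCos, eq_div_iff (by positivity), sin_innerAngle, sin_innerAngle, cos_innerAngle,
    cos_innerAngle, cos_innerAngle, fin3_add_one_add_one,
    fin3_add_one_add_two, fin3_add_two_add_one, fin3_add_two_add_two]
  have h0 := T.sinhEdge_pos i
  have h1 := T.sinhEdge_pos (i + 1)
  have h2 := T.sinhEdge_pos (i + 2)
  have h0' := T.sinhEdge_sq i
  have hg := sq_sqrt T.gram_pos.le
  have hg' := T.gram_rotate i
  generalize √T.gram = g at *
  generalize √(T.coshEdge i ^ 2 - 1) = s0 at *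
  generalize √(T.coshEdge (i + 1) ^ 2 - 1) = s1 at *
  generalize √(T.coshEdge (i + 2) ^ 2 - 1) = s2 at *
  field_simp
  rw [hg, h0', hg']
  ring

theorem innerAngle_mem_hyperbolicDomain : T.innerAngle ∈ hyperbolicDomain := by
  have hm := T.innerAngle_mem
  have hs := T.sin_innerAngle_pos
  -- Now the edge cosine exceeds 1, and the spherical inequality is reversed.
  have h1 : ∀ i, T.innerAngle i < |π - T.innerAngle (i + 1) - T.innerAngle (i + 2)| := by
    intro i
    have a0 := hm i
    have s1 := hs (i + 1)
    have s2 := hs (i + 2)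
    by_contra! hcon
    have hc := cos_le_cos_of_nonneg_of_le_pi (abs_nonneg _) a0.2.le hcon
    rw [cos_abs, sub_sub, cos_pi_sub, cos_add] at hc
    have h := T.one_lt_coshEdge i
    rw [T.coshEdge_eq_edgeCos, edgeCos, one_lt_div (by positivity)] at h
    linarith
  refine ⟨hm, ?_⟩
  rw [Fin.sum_univ_three]
  have h := h1 0
  have h' := h1 1
  have h'' := h1 2
  simp only [zero_add, Fin.isValue, Fin.reduceAdd] at h h' h''
  have m0 := hm 0
  have m1 := hm 1
  have m2 := hm 2
  -- The positive sign is the claim. The negative sign cannot occur for two indices, since adding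
  -- the two inequalities would make the third angle exceed π.
  rcases lt_abs.1 h with h | h
  · linarith
  · rcases lt_abs.1 h' with h' | h' <;> linarith

theorem edge_eq_arcosh (i : Fin 3) : T.edge i = arcosh (edgeCos T.innerAngle i) := by
  rw [← T.coshEdge_eq_edgeCos, edge, coshEdge]

theorem exists_innerAngle_eq {x : Fin 3 → ℝ} (hx : x ∈ hyperbolicDomain) :
    ∃ T : HyperbolicTriangle, T.innerAngle = x := by
  have hs := sin_pos_of_hyperbolic hx
  have hG : 0 < -angleGram x := neg_pos.2 (angleGram_neg hx)
  have hc : ∀ i, edgeCos x i ^ 2 - 1 =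
      -angleGram x / (sin (x (i + 1)) * sin (x (i + 2))) ^ 2 := fun i => by
    rw [neg_div, ← one_sub_edgeCos_sq hs]; ring
  have hlaw := edgeCos_sub_mul hs
  have hpos : ∀ i, 0 < edgeCos x i ^ 2 - 1 := fun i => by
    rw [hc]; exact div_pos hG (pow_pos (mul_pos (hs _) (hs _)) 2)
  -- The sign puts the vertices constructed below on the upper sheet.
  have hge : ∀ i, 0 < edgeCos x i := fun i => by
    have h := one_add_edgeCos hs i
    have h1 := one_sub_edgeCos hs i
    have : 1 - edgeCos x i < 0 := by
      rw [h1]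
      exact div_neg_of_neg_of_pos (neg_neg_of_pos (mul_pos (mul_pos two_pos (sin_sum_pos hx))
        (sin_starAngle_pos_of_hyperbolic hx i))) (mul_pos (hs _) (hs _))
    linarith
  have hsq : ∀ i, √(edgeCos x i ^ 2 - 1) ^ 2 = edgeCos x i ^ 2 - 1 := fun i =>
    sq_sqrt (hpos i).le
  have hcos : ∀ i, edgeCos x (i + 1) * edgeCos x (i + 2) - edgeCos x i =
      √(edgeCos x (i + 1) ^ 2 - 1) * √(edgeCos x (i + 2) ^ 2 - 1) * cos (x i) := by
    intro i
    have := hs i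
    have := hs (i + 1)
    have := hs (i + 2)
    rw [← neg_sub, hlaw, hc (i + 1), hc (i + 2), sqrt_div hG.le, sqrt_div hG.le,
      fin3_add_one_add_one, fin3_add_one_add_two, fin3_add_two_add_one, fin3_add_two_add_two,
      sqrt_sq (by positivity), sqrt_sq (by positivity)]
    have hg := sq_sqrt hG.le
    field_simp
    rw [hg]
    ring
  have hG0 : ∀ i, 0 < √(edgeCos x i ^ 2 - 1) := fun i => sqrt_pos.2 (hpos i)
  let v : Fin 3 → Fin 3 → ℝ := ![![0, 0, 1], ![√(edgeCos x 2 ^ 2 - 1), 0, edgeCos x 2],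
    ![√(edgeCos x 1 ^ 2 - 1) * cos (x 0), √(edgeCos x 1 ^ 2 - 1) * sin (x 0), edgeCos x 1]]
  have hdet : (Matrix.of v).det ≠ 0 := by
    have := hG0 1
    have := hG0 2
    have := hs 0
    simp only [Matrix.det_fin_three, Matrix.of_apply]
    simp [v]
    refine ⟨by positivity, by positivity, by positivity⟩
  have hli : LinearIndependent ℝ v :=
    Matrix.linearIndependent_rows_iff_isUnit.2
      ((Matrix.isUnit_iff_isUnit_det _).2 hdet.isUnit)
  have hnorm : ∀ i, lorentz (v i) (v i) = -1 := by
    intro i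
    have h1 := hsq 1
    have h2 := hsq 2
    have h3 := sin_sq_add_cos_sq (x 0)
    fin_cases i
    · simp [v, lorentz]
    · simp [v, lorentz]
      linear_combination h2
    · simp [v, lorentz]
      linear_combination (√(edgeCos x 1 ^ 2 - 1) ^ 2) * h3 + h1
  have hpos2 : ∀ i, 0 < v i 2 := by
    intro i
    fin_cases i
    · simp [v]
    · simpa [v] using hge 2
    · simpa [v] using hge 1
  let T : HyperbolicTriangle := ⟨v, hnorm, hpos2, hli⟩
  have hT : ∀ i, T.coshEdge i = edgeCos x i := by
    intro i
    have h := hcos 0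
    simp only [zero_add] at h
    fin_cases i
    · simp [coshEdge, T, v, lorentz]
      linarith
    · simp [coshEdge, T, v, lorentz]
    · simp [coshEdge, T, v, lorentz]
  refine ⟨T, funext fun i => ?_⟩
  refine injOn_cos ⟨(T.innerAngle_mem i).1.le, (T.innerAngle_mem i).2.le⟩
    ⟨(hx.1 i).1.le, (hx.1 i).2.le⟩ ?_
  rw [T.cos_innerAngle, hT, hT, hT, hcos]
  have := hG0 (i + 1)
  have := hG0 (i + 2)
  field_simp

theorem range_innerAngle : range innerAngle = hyperbolicDomain := by
  ext x
  exact ⟨fun ⟨T, hT⟩ => hT ▸ T.innerAngle_mem_hyperbolicDomain, exists_innerAngle_eq⟩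

theorem edge_eq_hyperbolicEdge : T.edge = hyperbolicEdge T.innerAngle := by
  obtain ⟨T', hT', hy⟩ := Classical.epsilon_spec
    (p := fun y => ∃ T' : HyperbolicTriangle, T'.innerAngle = T.innerAngle ∧ T'.edge = y)
    ⟨T.edge, T, rfl, rfl⟩
  rw [hyperbolicEdge, ← hy]
  funext i
  rw [T.edge_eq_arcosh, T'.edge_eq_arcosh, hT']

end HyperbolicTriangle

/-- Here 1 - cosh y < 0; because `Real.log` ignores the sign, the formula keeps its spherical shape
and `log_edge_ratio` applies unchanged. -/
theorem log_tanh_half {y : ℝ} (h0 : 0 < y) :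
    log (tanh (y / 2)) = (log (1 - cosh y) - log (1 + cosh y)) / 2 := by
  have hs : 0 < sinh (y / 2) := sinh_pos_iff.2 (by linarith)
  have hc : 0 < cosh (y / 2) := cosh_pos _
  have h : cosh y = cosh (y / 2) ^ 2 + sinh (y / 2) ^ 2 := by rw [← cosh_two_mul]; ring_nf
  have h2 := cosh_sq (y / 2)
  have h' : 1 - cosh y = -(2 * sinh (y / 2) ^ 2) := by rw [h, h2]; ring
  have h'' : 1 + cosh y = 2 * cosh (y / 2) ^ 2 := by rw [h, h2]; ring
  rw [h', h'', tanh_eq_sinh_div_cosh, log_div hs.ne' hc.ne', log_neg_eq_log,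
    log_mul two_ne_zero (by positivity),
    log_mul two_ne_zero (by positivity), log_pow, log_pow]
  push_cast
  ring

theorem hyperbolicForm_eq {x : Fin 3 → ℝ} (hx : x ∈ hyperbolicDomain) :
    hyperbolicForm x = logRatioForm x := by
  obtain ⟨T, rfl⟩ := HyperbolicTriangle.exists_innerAngle_eq hx
  unfold hyperbolicForm logRatioForm
  refine Finset.sum_congr rfl fun i _ => ?_
  rw [← T.edge_eq_hyperbolicEdge, log_tanh_half (T.edge_pos i), T.cosh_edge,
    T.coshEdge_eq_edgeCos, log_edge_ratio (sin_pos_of_hyperbolic hx)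
      (sin_starAngle_pos_of_hyperbolic hx) (sin_sum_pos hx).ne']

/-! ### The capacities -/

theorem potential_basePoint : potential basePoint = -(4 * lobachevsky (π / 4)) := by
  have h : ∀ i, starAngle basePoint i = π / 4 := fun i => by
    unfold starAngle basePoint; ring
  have h' : (π + basePoint 0 + basePoint 1 + basePoint 2) / 2 = π / 4 + π := by
    unfold basePoint; ring
  rw [potential, h', lobachevsky_add_pi]
  simp only [h, Fin.sum_univ_three]
  ring

theorem potential_zero : potential 0 = 0 := by
  simp [potential, starAngle, lobachevsky_pi_div_two]

theorem basePoint_mem : basePoint ∈ sphericalDomain := by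
  refine ⟨fun i => ?_, ?_, fun i => ?_⟩
  · unfold basePoint; constructor <;> linarith [pi_pos]
  · rw [Fin.sum_univ_three]; unfold basePoint; linarith [pi_pos]
  · unfold starAngle basePoint; linarith [pi_pos]

theorem curveIntegral_sphericalForm {x : Fin 3 → ℝ} (γ : Path basePoint x)
    (hγ : IsPiecewiseC1 γ) (hγD : ∀ t, γ t ∈ sphericalDomain) :
    CurveIntegrable sphericalForm γ ∧
      curveIntegral sphericalForm γ = potential x + 4 * lobachevsky (π / 4) := by
  have h := curveIntegral_eq_sub_of_isPiecewiseC1 (D := sphericalDomain) (ω := sphericalForm)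
    (ω' := logRatioForm) continuous_potential (fun x hx => ?_) (fun x hx => sphericalForm_eq hx)
    (fun x hx => ?_) γ hγ fun t _ => hγD t
  · rwa [potential_basePoint, sub_neg_eq_add] at h
  · rw [sphericalForm_eq hx]
    exact hasFDerivAt_potential (fun i => (sin_starAngle_pos_of_spherical hx i).ne')
      (sin_sum_neg hx).ne
  · rw [insert_eq_of_mem basePoint_mem] at hx
    exact continuousAt_logRatioForm (fun i => (sin_starAngle_pos_of_spherical hx i).ne')
      (sin_sum_neg hx).ne

theorem curveIntegral_hyperbolicForm {x : Fin 3 → ℝ} (γ : Path 0 x)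
    (hγ : IsPiecewiseC1 γ) (hγD : ∀ t, t ≠ 0 → γ t ∈ hyperbolicDomain) :
    CurveIntegrable hyperbolicForm γ ∧ curveIntegral hyperbolicForm γ = potential x := by
  have h := curveIntegral_eq_sub_of_isPiecewiseC1 (D := hyperbolicDomain) (ω := hyperbolicForm)
    (ω' := logRatioForm) continuous_potential (fun x hx => ?_) (fun x hx => hyperbolicForm_eq hx)
    (fun x hx => ?_) γ hγ hγD
  · rwa [potential_zero, sub_zero] at h
  · rw [hyperbolicForm_eq hx]
    exact hasFDerivAt_potential (fun i => (sin_starAngle_pos_of_hyperbolic hx i).ne')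
      (sin_sum_pos hx).ne'
  · rcases hx with rfl | hx
    -- At the origin every star angle and σ equal π/2, so the form extends continuously to this
    -- boundary point.
    · refine continuousAt_logRatioForm (fun i => ?_) ?_ <;> simp [starAngle]
    · exact continuousAt_logRatioForm (fun i => (sin_starAngle_pos_of_hyperbolic hx i).ne')
        (sin_sum_pos hx).ne'

theorem segment_mem_sphericalDomain {x : Fin 3 → ℝ} (hx : x ∈ sphericalDomain)
    (t : unitInterval) : Path.segment basePoint x t ∈ sphericalDomain := by
  obtain ⟨h1, h2, h3⟩ := hx
  obtain ⟨g1, g2, g3⟩ := basePoint_mem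
  rw [Fin.sum_univ_three] at h2 g2
  have key : ∀ a b c : ℝ, c < a → c < b → c < (1 - (t : ℝ)) * a + t * b := by
    intro a b c ha hb
    rcases t.2.1.eq_or_lt with h | h
    · rw [← h]; linarith
    · nlinarith [mul_pos h (sub_pos.2 hb), mul_nonneg (sub_nonneg.2 t.2.2) (sub_pos.2 ha).le]
  refine ⟨fun i => ⟨?_, ?_⟩, ?_, fun i => ?_⟩
  · rw [segment_apply]; exact key _ _ _ (g1 i).1 (h1 i).1
  · rw [segment_apply]
    have := key _ _ _ (neg_lt_neg (g1 i).2) (neg_lt_neg (h1 i).2)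
    linarith
  · rw [Fin.sum_univ_three]
    simp only [segment_apply]
    have := key _ _ _ g2 h2
    linarith
  · have := key _ _ _ (g3 i) (h3 i)
    unfold starAngle at *
    simp only [segment_apply]
    linarith

theorem segment_mem_hyperbolicDomain {x : Fin 3 → ℝ} (hx : x ∈ hyperbolicDomain)
    (t : unitInterval) (ht : t ≠ 0) : Path.segment 0 x t ∈ hyperbolicDomain := by
  obtain ⟨h1, h2⟩ := hx
  rw [Fin.sum_univ_three] at h2
  have h0 : 0 < (t : ℝ) := t.2.1.lt_of_ne fun h => ht (Subtype.ext h.symm)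
  have key : ∀ a : ℝ, 0 < a → a < π → t * a < π := fun a ha ha' =>
    (mul_le_of_le_one_left ha.le t.2.2).trans_lt ha'
  refine ⟨fun i => ⟨?_, ?_⟩, ?_⟩
  · rw [segment_apply]; have := mul_pos h0 (h1 i).1; simpa using this
  · rw [segment_apply]; simpa using key _ (h1 i).1 (h1 i).2
  · rw [Fin.sum_univ_three]
    simp only [segment_apply]
    have := key _ (add_pos (add_pos (h1 0).1 (h1 1).1) (h1 2).1) h2
    simp only [Pi.zero_apply]
    linarith

theorem sphericalCapacity_eq {x : Fin 3 → ℝ} (hx : x ∈ sphericalDomain) :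
    sphericalCapacity x = potential x + 4 * lobachevsky (π / 4) :=
  (curveIntegral_sphericalForm _ (isPiecewiseC1_segment _ _)
    (segment_mem_sphericalDomain hx)).2

theorem hyperbolicCapacity_eq {x : Fin 3 → ℝ} (hx : x ∈ hyperbolicDomain) :
    hyperbolicCapacity x = potential x :=
  (curveIntegral_hyperbolicForm _ (isPiecewiseC1_segment _ _)
    (segment_mem_hyperbolicDomain hx)).2

/-! ### The iterated integral for an ideal tetrahedron. -/

theorem lintegral_Ioi_of_hasDerivAt_of_nonneg {g g' : ℝ → ℝ} {m : ℝ}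
    (hd : ∀ x ∈ Ici (0 : ℝ), HasDerivAt g (g' x) x) (hp : ∀ x ∈ Ioi (0 : ℝ), 0 ≤ g' x)
    (hm : Tendsto g atTop (𝓝 m)) :
    ∫⁻ x in Ioi (0 : ℝ), ENNReal.ofReal (g' x) = ENNReal.ofReal (m - g 0) := by
  rw [← integral_Ioi_of_hasDerivAt_of_nonneg' hd hp hm,
    ofReal_integral_eq_lintegral_ofReal (integrableOn_Ioi_deriv_of_nonneg' hd hp hm)
      ((ae_restrict_mem measurableSet_Ioi).mono hp)]

theorem lintegral_inv_sq {c K L : ℝ} (hc : 0 ≤ c) (hK : 0 < K) (hL : 0 < L) :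
    ∫⁻ a in Ioi (0 : ℝ), ENNReal.ofReal (c / (a * K + L) ^ 2) = ENNReal.ofReal (c / (K * L)) := by
  rw [lintegral_Ioi_of_hasDerivAt_of_nonneg (g := fun a => -(c / K) / (a * K + L)) (m := 0)]
  · congr 1; field_simp; ring
  · intro a ha
    have hpos : 0 < a * K + L := by have := mul_nonneg (mem_Ici.1 ha) hK.le; linarith
    have h1 : HasDerivAt (fun a : ℝ => a * K + L) K a := by
      simpa using ((hasDerivAt_id a).mul_const K).add_const L
    refine ((hasDerivAt_const a (-(c / K))).div h1 hpos.ne').congr_deriv ?_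
    field_simp
    ring
  · intro a ha; positivity
  · refine Tendsto.const_div_atTop ?_ _
    exact tendsto_atTop_add_const_right _ _ (tendsto_id.atTop_mul_const hK)

theorem lintegral_inv_mul {X Y Z : ℝ} (hX : 0 < X) (hY : 0 < Y) (hZ : 0 < Z)
    (h : 0 < X * Y - Z) :
    ∫⁻ r in Ioi (0 : ℝ), ENNReal.ofReal (((X * Y - Z) / 2) / ((1 + r * X) * (Y + r * Z))) =
      ENNReal.ofReal ((log X + log Y - log Z) / 2) := by
  rw [lintegral_Ioi_of_hasDerivAt_of_nonneg
    (g := fun r => (log (1 + r * X) - log (Y + r * Z)) / 2) (m := (log X - log Z) / 2)]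
  · congr 1; simp; ring
  · intro r hr
    have hr : 0 ≤ r := hr
    have h1 : HasDerivAt (fun r : ℝ => 1 + r * X) X r := by
      simpa using ((hasDerivAt_id r).mul_const X).const_add 1
    have h2 : HasDerivAt (fun r : ℝ => Y + r * Z) Z r := by
      simpa using ((hasDerivAt_id r).mul_const Z).const_add Y
    have p1 : 0 < 1 + r * X := by positivity
    have p2 : 0 < Y + r * Z := by positivity
    refine (((h1.log p1.ne').sub (h2.log p2.ne')).div_const 2).congr_deriv ?_
    field_simp
    ring
  · intro r hr
    have hr : 0 < r := hr
    positivity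
  · refine Tendsto.div_const ?_ 2
    -- The limit comes from (1 + rX)/(Y + rZ) = X/Z - (XY - Z)/(Z(Y + rZ)).
    have h0 : Tendsto (fun r : ℝ => (X * Y - Z) / (Z * (Y + r * Z))) atTop (𝓝 0) := by
      refine Tendsto.const_div_atTop ?_ _
      exact (tendsto_atTop_add_const_left _ _ (tendsto_id.atTop_mul_const hZ)).const_mul_atTop hZ
    have h1 : Tendsto (fun r : ℝ => log (X / Z - (X * Y - Z) / (Z * (Y + r * Z)))) atTop
        (𝓝 (log (X / Z))) := by
      have := (tendsto_const_nhds (x := X / Z)).sub h0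
      rw [sub_zero] at this
      exact ((continuousAt_log (div_pos hX hZ).ne').tendsto).comp this
    rw [log_div hX.ne' hZ.ne'] at h1
    refine h1.congr' ?_
    filter_upwards [eventually_ge_atTop (0 : ℝ)] with r hr
    have p1 : 0 < 1 + r * X := by positivity
    have p2 : 0 < Y + r * Z := by positivity
    rw [← log_div p1.ne' p2.ne']
    congr 1
    field_simp
    ring

theorem sin_mul_sin_sub (A β γ φ : ℝ) (h : A + β + γ = π) :
    sin (φ + γ) * sin (φ + β) - sin φ * sin (A - φ) = sin β * sin γ := by
  have hA : A - φ = π - (φ + (β + γ)) := by linarith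
  rw [hA, sin_pi_sub, sin_add, sin_add, sin_add, sin_add, cos_add]
  linear_combination (sin β * sin γ) * sin_sq_add_cos_sq φ

/-- Four reflected or translated copies of ln|2 sin| are integrated. Since A + γ = π - β and A + β =
π - γ, each of the three values of Λ appears twice, against the factor 1/2. The integrand is
nonnegative by `sin_mul_sin_sub`; the resulting sign is recorded because `ENNReal.ofReal` is
additive only on nonnegative numbers. -/
theorem lintegral_log_sin_ratio {A β γ : ℝ} (hA : 0 < A) (hβ : 0 < β) (hγ : 0 < γ)
    (h : A + β + γ = π) :
    0 ≤ lobachevsky A + lobachevsky β + lobachevsky γ ∧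
    ∫⁻ φ in Ioo 0 A, ENNReal.ofReal
      ((log (sin (φ + γ)) + log (sin (φ + β)) - log (sin φ * sin (A - φ))) / 2) =
      ENNReal.ofReal (lobachevsky A + lobachevsky β + lobachevsky γ) := by
  let f : ℝ → ℝ := fun φ => (log |2 * sin (φ + γ)| + log |2 * sin (φ + β)| - log |2 * sin φ| -
    log |2 * sin (A - φ)|) / 2
  have hpos : ∀ φ ∈ Ioo 0 A, 0 < sin (φ + γ) ∧ 0 < sin (φ + β) ∧ 0 < sin φ ∧
      0 < sin (A - φ) := fun φ hφ =>
    ⟨sin_pos_of_pos_of_lt_pi (by linarith [hφ.1]) (by linarith [hφ.2]),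
      sin_pos_of_pos_of_lt_pi (by linarith [hφ.1]) (by linarith [hφ.2]),
      sin_pos_of_pos_of_lt_pi (by linarith [hφ.1]) (by linarith [hφ.2]),
      sin_pos_of_pos_of_lt_pi (by linarith [hφ.2]) (by linarith [hφ.1])⟩
  have hf : ∀ φ ∈ Ioo 0 A,
      (log (sin (φ + γ)) + log (sin (φ + β)) - log (sin φ * sin (A - φ))) / 2 = f φ := by
    intro φ hφ
    obtain ⟨h1, h2, h3, h4⟩ := hpos φ hφ
    simp only [f, log_abs]
    rw [log_mul h3.ne' h4.ne', log_mul two_ne_zero h1.ne', log_mul two_ne_zero h2.ne',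
      log_mul two_ne_zero h3.ne', log_mul two_ne_zero h4.ne']
    ring
  have hf0 : ∀ φ ∈ Ioo 0 A, 0 ≤ f φ := by
    intro φ hφ
    obtain ⟨h1, h2, h3, h4⟩ := hpos φ hφ
    rw [← hf φ hφ, ← log_mul h1.ne' h2.ne']
    have h5 : sin φ * sin (A - φ) ≤ sin (φ + γ) * sin (φ + β) := by
      have := sin_mul_sin_sub A β γ φ h
      have := mul_pos (sin_pos_of_pos_of_lt_pi hβ (by linarith))
        (sin_pos_of_pos_of_lt_pi hγ (by linarith))
      linarith
    have := log_le_log (mul_pos h3 h4) h5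
    linarith
  have i1 : IntervalIntegrable (fun φ => log |2 * sin (φ + γ)|) volume 0 A := by
    simpa using (intervalIntegrable_log_sin' (0 + γ) (A + γ)).comp_add_right γ
  have i2 : IntervalIntegrable (fun φ => log |2 * sin (φ + β)|) volume 0 A := by
    simpa using (intervalIntegrable_log_sin' (0 + β) (A + β)).comp_add_right β
  have i3 := intervalIntegrable_log_sin' 0 A
  have i4 : IntervalIntegrable (fun φ => log |2 * sin (A - φ)|) volume 0 A := by
    simpa using (intervalIntegrable_log_sin' A 0).comp_sub_left A
  have hint : IntervalIntegrable f volume 0 A :=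
    (((i1.add i2).sub i3).sub i4).div_const 2
  have hval : ∫ φ in (0 : ℝ)..A, f φ = lobachevsky A + lobachevsky β + lobachevsky γ := by
    simp only [f]
    rw [intervalIntegral.integral_div, intervalIntegral.integral_sub ((i1.add i2).sub i3) i4,
      intervalIntegral.integral_sub (i1.add i2) i3, intervalIntegral.integral_add i1 i2,
      intervalIntegral.integral_comp_add_right (fun φ => log |2 * sin φ|),
      intervalIntegral.integral_comp_add_right (fun φ => log |2 * sin φ|),
      intervalIntegral.integral_comp_sub_left (fun φ => log |2 * sin φ|),
      integral_log_sin_eq, integral_log_sin_eq, integral_log_sin_eq, integral_log_sin_eq,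
      zero_add, zero_add, sub_self, sub_zero, lobachevsky_zero,
      show A + γ = π - β by linarith, show A + β = π - γ by linarith, lobachevsky_pi_sub,
      lobachevsky_pi_sub]
    ring
  rw [intervalIntegral.integral_of_le hA.le, integral_Ioc_eq_integral_Ioo] at hval
  constructor
  · rw [← hval]
    exact setIntegral_nonneg measurableSet_Ioo hf0
  · rw [setLIntegral_congr_fun measurableSet_Ioo
      (fun φ hφ => congrArg ENNReal.ofReal (hf φ hφ)), ← hval,
      ofReal_integral_eq_lintegral_ofReal]
    · exact ((intervalIntegrable_iff_integrableOn_Ioc_of_le hA.le).1 hint).mono_set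
        Ioo_subset_Ioc_self
    · exact (ae_restrict_mem measurableSet_Ioo).mono hf0

theorem lintegral_fin_three {f : (Fin 3 → ℝ) → ENNReal} (hf : Measurable f) :
    ∫⁻ u, f u = ∫⁻ z, ∫⁻ y, ∫⁻ x, f ![x, y, z] := by
  have h1 := (volume_preserving_piFinSuccAbove (fun _ : Fin 3 => ℝ) 2).symm
  have h2 := (volume_preserving_finTwoArrow ℝ).symm
  rw [← h1.lintegral_comp hf, Measure.volume_eq_prod, lintegral_prod _ (by fun_prop)]
  refine lintegral_congr fun z => ?_
  rw [← h2.lintegral_comp (by fun_prop), Measure.volume_eq_prod, lintegral_prod_symm _ (by fun_prop)]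
  refine lintegral_congr fun y => lintegral_congr fun x => ?_
  congr 1
  ext i
  fin_cases i <;> rfl

/-- The domain of the parameters of an ideal tetrahedron. -/
def paramDomain (A : ℝ) : Set (Fin 3 → ℝ) := {u | 0 < u 0 ∧ 0 < u 1 ∧ 0 < u 2 ∧ u 2 < A}

theorem measurableSet_paramDomain (A : ℝ) : MeasurableSet (paramDomain A) := by
  unfold paramDomain; measurability

theorem lintegral_paramDomain {f : (Fin 3 → ℝ) → ENNReal} (hf : Measurable f) (A : ℝ) :
    ∫⁻ u in paramDomain A, f u =
      ∫⁻ φ in Ioo 0 A, ∫⁻ r in Ioi (0 : ℝ), ∫⁻ a in Ioi (0 : ℝ), f ![a, r, φ] := by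
  rw [← lintegral_indicator (measurableSet_paramDomain A),
    lintegral_fin_three (hf.indicator (measurableSet_paramDomain A)),
    ← lintegral_indicator measurableSet_Ioo]
  refine lintegral_congr fun φ => ?_
  by_cases hφ : φ ∈ Ioo 0 A
  · rw [indicator_of_mem hφ, ← lintegral_indicator measurableSet_Ioi]
    refine lintegral_congr fun r => ?_
    by_cases hr : r ∈ Ioi (0 : ℝ)
    · rw [indicator_of_mem hr, ← lintegral_indicator measurableSet_Ioi]
      refine lintegral_congr fun a => ?_
      by_cases ha : a ∈ Ioi (0 : ℝ)
      · rw [indicator_of_mem ha, indicator_of_mem]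
        exact ⟨ha, hr, hφ⟩
      · rw [indicator_of_notMem ha, indicator_of_notMem]
        exact fun h => ha h.1
    · rw [indicator_of_notMem hr]
      exact lintegral_eq_zero_of_ae_eq_zero (Eventually.of_forall fun a =>
        indicator_of_notMem (fun h => hr h.2.1) _)
  · rw [indicator_of_notMem hφ]
    refine lintegral_eq_zero_of_ae_eq_zero (Eventually.of_forall fun r => ?_)
    exact lintegral_eq_zero_of_ae_eq_zero (Eventually.of_forall fun a =>
        indicator_of_notMem (fun h => hφ h.2.2) _)

/-- The integrals over `u 0` and `u 1` are `lintegral_inv_sq` and `lintegral_inv_mul`; the latter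
fits because its XY - Z is sin β sin γ for every φ. The value is Milnor's volume of the ideal
tetrahedron with dihedral angles A, β, γ. -/
theorem lintegral_paramDomain_density {A β γ : ℝ} (hA : 0 < A) (hβ : 0 < β) (hγ : 0 < γ)
    (h : A + β + γ = π) :
    0 ≤ lobachevsky A + lobachevsky β + lobachevsky γ ∧
    ∫⁻ u in paramDomain A, ENNReal.ofReal (sin β * sin γ / 2 * u 1 /
      (u 0 * (1 + u 1 * sin (u 2 + γ)) +
        u 1 * (sin (u 2 + β) + u 1 * (sin (u 2) * sin (A - u 2)))) ^ 2) =
      ENNReal.ofReal (lobachevsky A + lobachevsky β + lobachevsky γ) := by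
  obtain ⟨h0, hl⟩ := lintegral_log_sin_ratio hA hβ hγ h
  refine ⟨h0, ?_⟩
  rw [lintegral_paramDomain (by fun_prop), ← hl]
  refine setLIntegral_congr_fun measurableSet_Ioo fun φ hφ => ?_
  have hX : 0 < sin (φ + γ) :=
    sin_pos_of_pos_of_lt_pi (by linarith [hφ.1]) (by linarith [hφ.2])
  have hY : 0 < sin (φ + β) :=
    sin_pos_of_pos_of_lt_pi (by linarith [hφ.1]) (by linarith [hφ.2])
  have hZ : 0 < sin φ * sin (A - φ) := mul_pos
    (sin_pos_of_pos_of_lt_pi (by linarith [hφ.1]) (by linarith [hφ.2]))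
    (sin_pos_of_pos_of_lt_pi (by linarith [hφ.2]) (by linarith [hφ.1]))
  have hsβ := sin_pos_of_pos_of_lt_pi hβ (by linarith)
  have hsγ := sin_pos_of_pos_of_lt_pi hγ (by linarith)
  have hid := sin_mul_sin_sub A β γ φ h
  have hD : 0 < sin (φ + γ) * sin (φ + β) - sin φ * sin (A - φ) := by rw [hid]; positivity
  rw [← lintegral_inv_mul hX hY hZ hD]
  refine setLIntegral_congr_fun measurableSet_Ioi fun r hr => ?_
  have hr : 0 < r := hr
  simp only [Matrix.cons_val]
  rw [lintegral_inv_sq (by positivity) (by positivity) (by positivity), hid]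
  congr 1
  field_simp

/-! ### The Klein density and coordinates on a tetrahedron. -/

/-- With d = 1 - |p|² the metric is I/d + ppᵀ/d², of determinant d⁻³(1 + |p|²/d) = d⁻⁴. -/
theorem kleinDensity_eq {p : E3} (hp : 0 < 1 - ‖p‖ ^ 2) :
    kleinDensity p = 1 / (1 - ‖p‖ ^ 2) ^ 2 := by
  have hn : ‖p‖ ^ 2 = p 0 ^ 2 + p 1 ^ 2 + p 2 ^ 2 := by
    rw [EuclideanSpace.norm_sq_eq, Fin.sum_univ_three]; simp
  have hM : (Matrix.of fun i j : Fin 3 =>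
      kleinMetric p (EuclideanSpace.single i 1) (EuclideanSpace.single j 1)) =
      Matrix.of fun i j : Fin 3 => (if i = j then 1 else 0) / (1 - ‖p‖ ^ 2) +
        p i * p j / (1 - ‖p‖ ^ 2) ^ 2 := by
    ext i j
    simp [kleinMetric, EuclideanSpace.inner_single_right, eq_comm]
  have hdet : (Matrix.of fun i j : Fin 3 => (if i = j then 1 else 0) / (1 - ‖p‖ ^ 2) +
        p i * p j / (1 - ‖p‖ ^ 2) ^ 2).det = (1 / (1 - ‖p‖ ^ 2) ^ 2) ^ 2 := by
    have hd : p 0 ^ 2 + p 1 ^ 2 + p 2 ^ 2 = 1 - (1 - ‖p‖ ^ 2) := by rw [← hn]; ring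
    generalize 1 - ‖p‖ ^ 2 = d at *
    simp [Matrix.det_fin_three]
    field_simp
    linear_combination d ^ 2 * hd
  rw [kleinDensity, hM, hdet, sqrt_sq (by positivity)]

/-- The matrix of the derivative of a map, as a continuous linear map. -/
noncomputable def matCLM (M : Matrix (Fin 3) (Fin 3) ℝ) : (Fin 3 → ℝ) →L[ℝ] (Fin 3 → ℝ) :=
  LinearMap.toContinuousLinearMap (Matrix.toLin' M)

theorem det_matCLM (M : Matrix (Fin 3) (Fin 3) ℝ) : (matCLM M).det = M.det := by
  rw [ContinuousLinearMap.det, matCLM, LinearMap.coe_toContinuousLinearMap, LinearMap.det_toLin']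

theorem matCLM_apply (M : Matrix (Fin 3) (Fin 3) ℝ) (v : Fin 3 → ℝ) (i : Fin 3) :
    matCLM M v i = M i 0 * v 0 + M i 1 * v 1 + M i 2 * v 2 := by
  simp [matCLM, Matrix.toLin'_apply, Matrix.mulVec, dotProduct, Fin.sum_univ_three]

/-- The passage from homogeneous barycentric weights `(w₀, k, w₁, w₂)` with respect to the points
`e₀, -e₀, e₁, e₂` to Cartesian coordinates. -/
noncomputable def projMap (k : ℝ) (w : Fin 3 → ℝ) : Fin 3 → ℝ :=
  ![(w 0 - k) / (w 0 + w 1 + w 2 + k), w 1 / (w 0 + w 1 + w 2 + k), w 2 / (w 0 + w 1 + w 2 + k)]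

/-- The weights as functions of the parameters. -/
noncomputable def weightMap (a b c A : ℝ) (u : Fin 3 → ℝ) : Fin 3 → ℝ :=
  ![a * u 0, b * (u 1 * sin (A - u 2)), c * (u 1 * sin (u 2))]

theorem hasFDerivAt_projMap {k : ℝ} {w : Fin 3 → ℝ} (h : w 0 + w 1 + w 2 + k ≠ 0) :
    HasFDerivAt (projMap k) (matCLM (Matrix.of
      ![![(w 1 + w 2 + 2 * k) / (w 0 + w 1 + w 2 + k) ^ 2, -(w 0 - k) / (w 0 + w 1 + w 2 + k) ^ 2,
          -(w 0 - k) / (w 0 + w 1 + w 2 + k) ^ 2],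
        ![-w 1 / (w 0 + w 1 + w 2 + k) ^ 2, (w 0 + w 2 + k) / (w 0 + w 1 + w 2 + k) ^ 2,
          -w 1 / (w 0 + w 1 + w 2 + k) ^ 2],
        ![-w 2 / (w 0 + w 1 + w 2 + k) ^ 2, -w 2 / (w 0 + w 1 + w 2 + k) ^ 2,
          (w 0 + w 1 + k) / (w 0 + w 1 + w 2 + k) ^ 2]])) w := by
  have hp : ∀ i, HasFDerivAt (fun x : Fin 3 → ℝ => x i)
    (ContinuousLinearMap.proj i : (Fin 3 → ℝ) →L[ℝ] ℝ) w := fun i => hasFDerivAt_apply i w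
  have hN : HasFDerivAt (fun x : Fin 3 → ℝ => x 0 + x 1 + x 2 + k)
      ((ContinuousLinearMap.proj 0 : (Fin 3 → ℝ) →L[ℝ] ℝ) + ContinuousLinearMap.proj 1 +
        ContinuousLinearMap.proj 2) w := (((hp 0).add (hp 1)).add (hp 2)).add_const k
  have hI : HasFDerivAt (fun x : Fin 3 → ℝ => (x 0 + x 1 + x 2 + k)⁻¹) _ w :=
    HasDerivAt.comp_hasFDerivAt (h₂ := fun z => z⁻¹) w (hasDerivAt_inv h) hN
  refine hasFDerivAt_pi'.2 fun i => ?_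
  fin_cases i
  · have := (((hp 0).sub_const k).fun_mul hI)
    refine HasFDerivAt.congr_fderiv (f := fun x : Fin 3 → ℝ => (x 0 - k) / _)
      (by simpa only [div_eq_mul_inv] using this) ?_
    ext v
    simp [matCLM_apply]
    field_simp
    ring
  · have := ((hp 1).fun_mul hI)
    refine HasFDerivAt.congr_fderiv (f := fun x : Fin 3 → ℝ => x 1 / _)
      (by simpa only [div_eq_mul_inv] using this) ?_
    ext v
    simp [matCLM_apply]
    field_simp
    ring
  · have := ((hp 2).fun_mul hI)
    refine HasFDerivAt.congr_fderiv (f := fun x : Fin 3 → ℝ => x 2 / _)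
      (by simpa only [div_eq_mul_inv] using this) ?_
    ext v
    simp [matCLM_apply]
    field_simp
    ring

theorem hasFDerivAt_weightMap (a b c A : ℝ) (u : Fin 3 → ℝ) :
    HasFDerivAt (weightMap a b c A) (matCLM (Matrix.of
      ![![a, 0, 0], ![0, b * sin (A - u 2), -(b * (u 1 * cos (A - u 2)))],
        ![0, c * sin (u 2), c * (u 1 * cos (u 2))]])) u := by
  have hp : ∀ i, HasFDerivAt (fun x : Fin 3 → ℝ => x i)
    (ContinuousLinearMap.proj i : (Fin 3 → ℝ) →L[ℝ] ℝ) u := fun i => hasFDerivAt_apply i u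
  refine hasFDerivAt_pi'.2 fun i => ?_
  fin_cases i
  · refine ((hp 0).const_mul a).congr_fderiv ?_
    ext v
    simp [matCLM_apply]
  · refine (((hp 1).mul ((hp 2).const_sub A).sin).const_mul b).congr_fderiv ?_
    ext v
    simp [matCLM_apply]
    ring
  · refine (((hp 1).mul (hp 2).sin).const_mul c).congr_fderiv ?_
    ext v
    simp [matCLM_apply]
    ring

/-- One quarter of the standard octahedron. -/
def posTetrahedron : Set (Fin 3 → ℝ) := {y | 0 < y 1 ∧ 0 < y 2 ∧ |y 0| + y 1 + y 2 < 1}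

/-- The target is the open tetrahedron on e₀, -e₀, e₁, e₂; fixing the weight k of -e₀ removes the
scaling freedom of homogeneous weights. -/
theorem bijOn_projMap {k : ℝ} (hk : 0 < k) :
    BijOn (projMap k) {w | ∀ i, 0 < w i} posTetrahedron := by
  refine ⟨fun w hw => ?_, fun w hw w' hw' h => ?_, fun y hy => ?_⟩
  · have h0 := hw 0
    have h1 := hw 1
    have h2 := hw 2
    have hN : 0 < w 0 + w 1 + w 2 + k := by positivity
    refine ⟨?_, ?_, ?_⟩
    · simp only [projMap, Matrix.cons_val]; positivity
    · simp only [projMap, Matrix.cons_val]; positivity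
    · simp only [projMap, Matrix.cons_val]
      rw [abs_div, abs_of_pos hN, ← add_div, ← add_div, div_lt_one hN]
      have : |w 0 - k| < w 0 + k := abs_lt.2 ⟨by linarith, by linarith⟩
      linarith
  · have hN : 0 < w 0 + w 1 + w 2 + k := by have := hw 0; have := hw 1; have := hw 2; positivity
    have hN' : 0 < w' 0 + w' 1 + w' 2 + k := by
      have := hw' 0; have := hw' 1; have := hw' 2; positivity
    have e0 := congrFun h 0
    have e1 := congrFun h 1
    have e2 := congrFun h 2
    simp only [projMap, Matrix.cons_val] at e0 e1 e2
    -- The barycentric coordinate of -e₀ is k/N = (1 - y₀ - y₁ - y₂)/2, so the image point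
    -- determines the total weight N. The witness for surjectivity uses the same N.
    have hE : w 0 + w 1 + w 2 + k = w' 0 + w' 1 + w' 2 + k := by
      have hk1 : k / (w 0 + w 1 + w 2 + k) = k / (w' 0 + w' 1 + w' 2 + k) := by
        have a1 : k / (w 0 + w 1 + w 2 + k) = (1 - (w 0 - k) / (w 0 + w 1 + w 2 + k) -
          w 1 / (w 0 + w 1 + w 2 + k) - w 2 / (w 0 + w 1 + w 2 + k)) / 2 := by
          field_simp; ring
        have a2 : k / (w' 0 + w' 1 + w' 2 + k) = (1 - (w' 0 - k) / (w' 0 + w' 1 + w' 2 + k) -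
          w' 1 / (w' 0 + w' 1 + w' 2 + k) - w' 2 / (w' 0 + w' 1 + w' 2 + k)) / 2 := by
          field_simp; ring
        rw [a1, a2, e0, e1, e2]
      rw [div_eq_div_iff hN.ne' hN'.ne'] at hk1
      exact (mul_left_cancel₀ hk.ne' hk1).symm
    rw [hE, div_left_inj' hN'.ne'] at e0 e1 e2
    ext i
    fin_cases i
    · simpa using e0
    · exact e1
    · exact e2
  · obtain ⟨h1, h2, h3⟩ := hy
    have h4 := le_abs_self (y 0)
    have h5 := neg_le_abs (y 0)
    have hd : 0 < 1 - y 0 - y 1 - y 2 := by linarith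
    refine ⟨![k / (1 - y 0 - y 1 - y 2) * (1 + y 0 - y 1 - y 2),
      2 * k / (1 - y 0 - y 1 - y 2) * y 1, 2 * k / (1 - y 0 - y 1 - y 2) * y 2], fun i => ?_, ?_⟩
    · fin_cases i
      · simp only [Fin.zero_eta, Matrix.cons_val]
        exact mul_pos (by positivity) (by linarith)
      · simp only [Fin.mk_one, Matrix.cons_val]; positivity
      · simp only [Fin.reduceFinMk, Matrix.cons_val]; positivity
    · have hN : k / (1 - y 0 - y 1 - y 2) * (1 + y 0 - y 1 - y 2) +
          2 * k / (1 - y 0 - y 1 - y 2) * y 1 + 2 * k / (1 - y 0 - y 1 - y 2) * y 2 + k =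
          2 * k / (1 - y 0 - y 1 - y 2) := by
        field_simp; ring
      ext i
      fin_cases i
      · simp only [projMap, Fin.zero_eta, Matrix.cons_val]
        rw [hN]; field_simp; ring
      · simp only [projMap, Fin.mk_one, Matrix.cons_val]
        rw [hN]; field_simp
      · simp only [projMap, Fin.reduceFinMk, Matrix.cons_val]
        rw [hN]; field_simp

/-- The ratio of the last two weights determines the angle `u 2`, through sin(A - φ)/sin φ on (0,
A); then `u 1` is their common scale. -/
theorem bijOn_weightMap {a b c A : ℝ} (ha : 0 < a) (hb : 0 < b) (hc : 0 < c) (hA : 0 < A)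
    (hA' : A < π) : BijOn (weightMap a b c A) (paramDomain A) {w | ∀ i, 0 < w i} := by
  have hsA := sin_pos_of_pos_of_lt_pi hA hA'
  refine ⟨fun u hu => ?_, fun u hu u' hu' h => ?_, fun w hw => ?_⟩
  · obtain ⟨h0, h1, h2, h3⟩ := hu
    have s1 := sin_pos_of_pos_of_lt_pi h2 (by linarith)
    have s2 : 0 < sin (A - u 2) := sin_pos_of_pos_of_lt_pi (by linarith) (by linarith)
    intro i
    fin_cases i
    · simp only [weightMap, Fin.zero_eta, Matrix.cons_val]; positivity
    · simp only [weightMap, Fin.mk_one, Matrix.cons_val]; positivity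
    · simp only [weightMap, Fin.reduceFinMk, Matrix.cons_val]; positivity
  · obtain ⟨h0, h1, h2, h3⟩ := hu
    obtain ⟨h0', h1', h2', h3'⟩ := hu'
    have e0 := congrFun h 0
    have e1 := congrFun h 1
    have e2 := congrFun h 2
    simp only [weightMap, Matrix.cons_val] at e0 e1 e2
    have e0 := mul_left_cancel₀ ha.ne' e0
    have e1 := mul_left_cancel₀ hb.ne' e1
    have e2 := mul_left_cancel₀ hc.ne' e2
    have s1 := sin_pos_of_pos_of_lt_pi h2 (by linarith)
    have e3 : u 1 * u' 1 * (sin A * sin (u 2 - u' 2)) = 0 := by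
      simp only [sin_sub] at e1 ⊢
      linear_combination (u' 1 * (sin A * cos (u' 2) - cos A * sin (u' 2))) * e2 -
        (u' 1 * sin (u' 2)) * e1
    have e4 : sin (u 2 - u' 2) = 0 := by
      rcases mul_eq_zero.1 e3 with h | h
      · exact absurd h (by positivity)
      · exact (mul_eq_zero.1 h).resolve_left hsA.ne'
    rw [sin_eq_zero_iff_of_lt_of_lt (by linarith) (by linarith), sub_eq_zero] at e4
    rw [← e4] at e2
    have e5 := mul_right_cancel₀ s1.ne' e2
    ext i
    fin_cases i
    · exact e0
    · exact e5
    · exact e4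
  · have h0 := hw 0
    have h1 := hw 1
    have h2 := hw 2
    obtain ⟨φ, hφ, hφ0⟩ : ∃ φ ∈ Ioo 0 A, w 1 / b * sin φ - w 2 / c * sin (A - φ) = 0 := by
      have hcont : ContinuousOn (fun φ => w 1 / b * sin φ - w 2 / c * sin (A - φ)) (Icc 0 A) := by
        fun_prop
      have := intermediate_value_Ioo hA.le hcont (a := 0) (by
        constructor
        · simp only [sin_zero, mul_zero, zero_sub, sub_zero]
          exact neg_neg_of_pos (by positivity)
        · simp only [sub_self, sin_zero, mul_zero, sub_zero]; positivity)
      exact this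
    have s1 := sin_pos_of_pos_of_lt_pi hφ.1 (hφ.2.trans hA')
    refine ⟨![w 0 / a, w 2 / c / sin φ, φ], ⟨?_, ?_, ?_, ?_⟩, ?_⟩
    · simp only [Matrix.cons_val]; positivity
    · simp only [Matrix.cons_val]; positivity
    · exact hφ.1
    · exact hφ.2
    · ext i
      fin_cases i
      · simp only [weightMap, Fin.zero_eta, Matrix.cons_val]; field_simp
      · simp only [weightMap, Fin.mk_one, Matrix.cons_val]
        field_simp at hφ0 ⊢
        linarith
      · simp only [weightMap, Fin.reduceFinMk, Matrix.cons_val]; field_simp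

/-- The Jacobians of `projMap` and `weightMap` are 2k/N⁴, with N the total weight, and abc · `u 1` ·
sin A. -/
theorem lintegral_posTetrahedron {a b c k A : ℝ} (ha : 0 < a) (hb : 0 < b) (hc : 0 < c)
    (hk : 0 < k) (hA : 0 < A) (hA' : A < π) (f : (Fin 3 → ℝ) → ENNReal) :
    ∫⁻ y in posTetrahedron, f y = ∫⁻ u in paramDomain A,
      ENNReal.ofReal (2 * k * (a * b * c * u 1 * sin A) /
        (weightMap a b c A u 0 + weightMap a b c A u 1 + weightMap a b c A u 2 + k) ^ 4) *
        f (projMap k (weightMap a b c A u)) := by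
  have hw := bijOn_weightMap ha hb hc hA hA'
  have hbij := (bijOn_projMap hk).comp hw
  rw [← hbij.image_eq, lintegral_image_eq_lintegral_abs_det_fderiv_mul volume
    (measurableSet_paramDomain A) (fun u hu => HasFDerivAt.hasFDerivWithinAt
      ((hasFDerivAt_projMap ?_).comp u (hasFDerivAt_weightMap a b c A u))) hbij.injOn]
  · refine setLIntegral_congr_fun (measurableSet_paramDomain A) fun u hu => ?_
    have h0 := hw.mapsTo hu 0
    have h1 := hw.mapsTo hu 1
    have h2 := hw.mapsTo hu 2
    have hsA := sin_pos_of_pos_of_lt_pi hA hA'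
    have hu1 := hu.2.1
    have hN : 0 < weightMap a b c A u 0 + weightMap a b c A u 1 + weightMap a b c A u 2 + k := by
      positivity
    simp only [Function.comp_apply]
    congr 2
    rw [ContinuousLinearMap.det, ContinuousLinearMap.toLinearMap_comp, LinearMap.det_comp]
    have e1 := det_matCLM
    simp only [ContinuousLinearMap.det] at e1
    rw [e1, e1]
    generalize weightMap a b c A u = w at *
    have hs : sin A = sin (A - u 2) * cos (u 2) + cos (A - u 2) * sin (u 2) := by
      rw [← sin_add]; ring_nf
    rw [← abs_of_pos (show 0 < 2 * k * (a * b * c * u 1 * sin A) / (w 0 + w 1 + w 2 + k) ^ 4 by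
      positivity)]
    congr 1
    rw [hs]
    simp only [Matrix.det_fin_three, Matrix.of_apply, Matrix.cons_val]
    field_simp
    ring
  · have h0 := hw.mapsTo hu 0
    have h1 := hw.mapsTo hu 1
    have h2 := hw.mapsTo hu 2
    positivity

/-! ### The volume of one ideal tetrahedron. -/

theorem sin_mul_sin_add {A β γ : ℝ} (h : A + β + γ = π) (φ : ℝ) :
    sin γ * sin (A - φ) + sin β * sin φ = sin A * sin (φ + γ) := by
  have hβ : sin β = sin A * cos γ + cos A * sin γ := by
    rw [← sin_add, ← sin_pi_sub]; congr 1; linarith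
  rw [hβ, sin_sub, sin_add]
  ring

/-- The left side is N²(1 - |p|²) for p the point with total weight N. All vertices are unit
vectors, so the squares of the weights drop out and only products wᵢwⱼ(1 - ⟨vᵢ, vⱼ⟩) remain. The
scalings in w0, w1, w2 are chosen to cancel the denominators sA, sB, sC, leaving a common factor 4ak
and a bracket linear in t. -/
theorem tetrahedron_form {sA sB sC a b c k A β γ φ ρ t c0 c1 c2 : ℝ} (hA : 0 < sA) (hB : 0 < sB)
    (hC : 0 < sC) (h : A + β + γ = π) (hsA : sA = sin A) (hb : b = sin β) (hc : c = sin γ)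
    (m0 : 1 - c0 = 2 * k * a / (sB * sC)) (m1 : 1 - c1 = 2 * k * b / (sC * sA))
    (m2 : 1 - c2 = 2 * k * c / (sA * sB)) (p1 : 1 + c1 = 2 * c * a / (sC * sA))
    (p2 : 1 + c2 = 2 * a * b / (sA * sB)) {w0 w1 w2 : ℝ} (hw0 : w0 = a * t)
    (hw1 : w1 = sB * (ρ * sin (A - φ))) (hw2 : w2 = sC * (ρ * sin φ)) :
    (w0 + w1 + w2 + k) ^ 2 - ((w0 - k) ^ 2 + w1 ^ 2 + w2 ^ 2 + 2 * ((w0 - k) * w1) * c2 +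
      2 * ((w0 - k) * w2) * c1 + 2 * (w1 * w2) * c0) =
    4 * a * k * (t * (1 + ρ * sin (φ + γ)) +
        ρ * (sin (φ + β) + ρ * (sin φ * sin (A - φ)))) := by
  have e1 := sin_mul_sin_add h φ
  have e2 := sin_mul_sin_add (show A + γ + β = π by linarith) φ
  rw [← hsA, ← hb, ← hc] at e1 e2
  have hE : (w0 + w1 + w2 + k) ^ 2 - ((w0 - k) ^ 2 + w1 ^ 2 + w2 ^ 2 + 2 * ((w0 - k) * w1) * c2 +
      2 * ((w0 - k) * w2) * c1 + 2 * (w1 * w2) * c0) = 4 * w0 * k + 2 * w0 * w1 * (1 - c2) +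
      2 * w0 * w2 * (1 - c1) + 2 * k * w1 * (1 + c2) + 2 * k * w2 * (1 + c1) +
      2 * w1 * w2 * (1 - c0) := by ring
  rw [hE, m0, m1, m2, p1, p2, hw0, hw1, hw2]
  field_simp
  linear_combination 4 * a * k * t * ρ * e1 + 4 * a * k * ρ * e2

namespace SphericalTriangle

variable (T : SphericalTriangle)

/-- The linear map taking the standard basis to the vertices. -/
noncomputable def toMap : (Fin 3 → ℝ) →ₗ[ℝ] E3 := Fintype.linearCombination ℝ T.vertex

theorem toMap_apply (y : Fin 3 → ℝ) :
    T.toMap y = y 0 • T.vertex 0 + y 1 • T.vertex 1 + y 2 • T.vertex 2 := by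
  rw [toMap, Fintype.linearCombination_apply, Fin.sum_univ_three]

theorem toMap_injective : Function.Injective T.toMap :=
  linearIndependent_iff_injective_fintypeLinearCombination.1 T.linearIndependent

theorem toMap_eq_toLp (y : Fin 3 → ℝ) :
    T.toMap y = WithLp.toLp 2 (matCLM T.mat.transpose y) := by
  ext i
  rw [toMap_apply]
  refine Eq.trans ?_ (matCLM_apply _ _ _).symm
  simp [mat]
  ring

theorem norm_toMap_sq (y : Fin 3 → ℝ) : ‖T.toMap y‖ ^ 2 =
    y 0 ^ 2 + y 1 ^ 2 + y 2 ^ 2 + 2 * (y 0 * y 1) * T.cosEdge 2 + 2 * (y 0 * y 2) * T.cosEdge 1 +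
      2 * (y 1 * y 2) * T.cosEdge 0 := by
  have h01 : ⟪T.vertex 0, T.vertex 1⟫ = T.cosEdge 2 := T.inner_add_one 0
  have h02 : ⟪T.vertex 0, T.vertex 2⟫ = T.cosEdge 1 := T.inner_add_two 0
  have h12 : ⟪T.vertex 1, T.vertex 2⟫ = T.cosEdge 0 := rfl
  rw [← real_inner_self_eq_norm_sq, toMap_apply]
  simp only [inner_add_left, inner_add_right, inner_smul_left, inner_smul_right, T.inner_self,
    real_inner_comm (T.vertex 0) (T.vertex 1), real_inner_comm (T.vertex 0) (T.vertex 2),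
    real_inner_comm (T.vertex 1) (T.vertex 2), h01, h02, h12, conj_trivial]
  ring

theorem lintegral_image_toMap {Q : Set (Fin 3 → ℝ)} (hQ : MeasurableSet Q) (f : E3 → ENNReal) :
    ∫⁻ p in T.toMap '' Q, f p =
      ENNReal.ofReal |T.mat.det| * ∫⁻ y in Q, f (T.toMap y) := by
  have h : T.toMap '' Q = WithLp.toLp 2 '' (matCLM T.mat.transpose '' Q) := by
    rw [image_image]; exact image_congr fun y _ => T.toMap_eq_toLp y
  have hinj : Function.Injective (matCLM T.mat.transpose) := fun y z hyz =>
    T.toMap_injective (by rw [toMap_eq_toLp, toMap_eq_toLp, hyz])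
  rw [h, ← (PiLp.volume_preserving_toLp (Fin 3)).setLIntegral_comp_emb
    (MeasurableEquiv.toLp 2 (Fin 3 → ℝ)).measurableEmbedding,
    lintegral_image_eq_lintegral_abs_det_fderiv_mul volume hQ
      (fun y _ => (matCLM T.mat.transpose).hasFDerivAt.hasFDerivWithinAt) hinj.injOn,
    det_matCLM, Matrix.det_transpose, lintegral_const_mul' _ _ ENNReal.ofReal_ne_top]
  simp only [toMap_eq_toLp]

theorem abs_det_mat : |T.mat.det| = angleGram T.innerAngle /
    (sin (T.innerAngle 0) * sin (T.innerAngle 1) * sin (T.innerAngle 2)) := by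
  have hs := T.sin_innerAngle_pos
  have h0 := hs 0
  have h1 := hs 1
  have h2 := hs 2
  have hG := angleGram_pos T.innerAngle_mem_sphericalDomain
  rw [← sq_eq_sq₀ (abs_nonneg _) (by positivity), sq_abs, det_mat_sq]
  have e0 := edgeCos_sub_mul hs 0
  have e1 := one_sub_edgeCos_sq hs 1
  have e2 := one_sub_edgeCos_sq hs 2
  simp only [← T.cosEdge_eq_edgeCos, zero_add, Fin.isValue, Fin.reduceAdd] at e0 e1 e2
  have hg : T.gram = (1 - T.cosEdge 1 ^ 2) * (1 - T.cosEdge 2 ^ 2) -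
      (T.cosEdge 0 - T.cosEdge 1 * T.cosEdge 2) ^ 2 := by rw [gram]; ring
  rw [hg, e0, e1, e2]
  have := sin_sq_add_cos_sq (T.innerAngle 0)
  field_simp
  linear_combination -this

theorem lintegral_tetrahedron :
    0 ≤ lobachevsky (T.innerAngle 0) + lobachevsky (starAngle T.innerAngle 1) +
      lobachevsky (starAngle T.innerAngle 2) ∧
    ∫⁻ p in T.toMap '' posTetrahedron, ENNReal.ofReal (kleinDensity p) =
      ENNReal.ofReal (lobachevsky (T.innerAngle 0) + lobachevsky (starAngle T.innerAngle 1) +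
        lobachevsky (starAngle T.innerAngle 2)) := by
  have hx := T.innerAngle_mem_sphericalDomain
  have hs := T.sin_innerAngle_pos
  have hdet := T.abs_det_mat
  have hGram := angleGram_eq hs
  have hm : ∀ i, 1 - T.cosEdge i = _ := fun i =>
    (congrArg (1 - ·) (T.cosEdge_eq_edgeCos i)).trans (one_sub_edgeCos hs i)
  have hp : ∀ i, 1 + T.cosEdge i = _ := fun i =>
    (congrArg (1 + ·) (T.cosEdge_eq_edgeCos i)).trans (one_add_edgeCos hs i)
  have hk := sin_sum_neg hx
  have hα := sin_starAngle_pos_of_spherical hx 0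
  have hβ := sin_starAngle_pos_of_spherical hx 1
  have hγ := sin_starAngle_pos_of_spherical hx 2
  have m0 := hm 0
  have m1 := hm 1
  have m2 := hm 2
  have p1 := hp 1
  have p2 := hp 2
  simp only [zero_add, Fin.isValue, Fin.reduceAdd] at m0 m1 m2 p1 p2
  set x := T.innerAngle with hxdef
  have hsum : x 0 + starAngle x 1 + starAngle x 2 = π := by
    simp only [starAngle, Fin.isValue, Fin.reduceAdd]; ring
  obtain ⟨hpos, hval⟩ := lintegral_paramDomain_density (hx.1 0).1 (hx.2.2 1) (hx.2.2 2) hsum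
  refine ⟨hpos, ?_⟩
  -- The weight of the vertex -v₀ is fixed to be the positive factor -sin σ common to all 1 -
  -- `edgeCos`.
  obtain ⟨k, hkdef⟩ : ∃ k, k = -sin ((π + x 0 + x 1 + x 2) / 2) := ⟨_, rfl⟩
  have hk0 : 0 < k := by rw [hkdef]; exact neg_pos.2 hk
  have hmeas : MeasurableSet posTetrahedron := by unfold posTetrahedron; measurability
  have hw := bijOn_weightMap hα (hs 1) (hs 2) (hx.1 0).1 (hx.1 0).2
  rw [T.lintegral_image_toMap hmeas, lintegral_posTetrahedron hα (hs 1) (hs 2) hk0 (hx.1 0).1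
    (hx.1 0).2, ← hval, ← lintegral_const_mul' _ _ ENNReal.ofReal_ne_top]
  refine setLIntegral_congr_fun (measurableSet_paramDomain _) fun u hu => ?_
  have hw0 := hw.mapsTo hu 0
  have hw1 := hw.mapsTo hu 1
  have hw2 := hw.mapsTo hu 2
  obtain ⟨u0, u1, u2, u3⟩ := hu
  have sX : 0 < sin (u 2 + starAngle x 2) :=
    sin_pos_of_pos_of_lt_pi (by linarith [hx.2.2 2]) (by linarith [hx.2.2 1])
  have sY : 0 < sin (u 2 + starAngle x 1) :=
    sin_pos_of_pos_of_lt_pi (by linarith [hx.2.2 1]) (by linarith [hx.2.2 2])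
  have sφ : 0 < sin (u 2) := sin_pos_of_pos_of_lt_pi u2 (by linarith [(hx.1 0).2])
  have sA : 0 < sin (x 0 - u 2) :=
    sin_pos_of_pos_of_lt_pi (by linarith) (by linarith [(hx.1 0).2])
  have key := tetrahedron_form (hs 0) (hs 1) (hs 2) hsum rfl rfl rfl
    (a := sin (starAngle x 0)) (k := k) (φ := u 2) (ρ := u 1) (t := u 0)
    (by rw [m0, hkdef]; ring) (by rw [m1, hkdef]; ring) (by rw [m2, hkdef]; ring) p1
    p2 (w0 := weightMap (sin (starAngle x 0)) (sin (x 1)) (sin (x 2)) (x 0) u 0)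
    (w1 := weightMap (sin (starAngle x 0)) (sin (x 1)) (sin (x 2)) (x 0) u 1)
    (w2 := weightMap (sin (starAngle x 0)) (sin (x 1)) (sin (x 2)) (x 0) u 2) rfl rfl rfl
  generalize weightMap (sin (starAngle x 0)) (sin (x 1)) (sin (x 2)) (x 0) u = w at *
  have hN : 0 < w 0 + w 1 + w 2 + k := by positivity
  have hn : 1 - ‖T.toMap (projMap k w)‖ ^ 2 = 4 * sin (starAngle x 0) * k *
      (u 0 * (1 + u 1 * sin (u 2 + starAngle x 2)) +
        u 1 * (sin (u 2 + starAngle x 1) + u 1 * (sin (u 2) * sin (x 0 - u 2)))) /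
      (w 0 + w 1 + w 2 + k) ^ 2 := by
    rw [← key, norm_toMap_sq, eq_div_iff (by positivity)]
    simp only [projMap, Matrix.cons_val]
    field_simp
  have hE : 0 < u 0 * (1 + u 1 * sin (u 2 + starAngle x 2)) +
        u 1 * (sin (u 2 + starAngle x 1) + u 1 * (sin (u 2) * sin (x 0 - u 2))) := by positivity
  generalize u 0 * (1 + u 1 * sin (u 2 + starAngle x 2)) +
        u 1 * (sin (u 2 + starAngle x 1) + u 1 * (sin (u 2) * sin (x 0 - u 2))) = E at *
  have hs0 := hs 0
  have hs1 := hs 1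
  have hs2 := hs 2
  have hn0 : 0 < 1 - ‖T.toMap (projMap k w)‖ ^ 2 := by rw [hn]; positivity
  rw [kleinDensity_eq hn0, hn, ← ENNReal.ofReal_mul (by positivity),
    ← ENNReal.ofReal_mul (by positivity), hdet, hGram]
  congr 1
  rw [show -(4 * sin ((π + x 0 + x 1 + x 2) / 2) * sin (starAngle x 0) * sin (starAngle x 1) *
    sin (starAngle x 2)) = 4 * k * sin (starAngle x 0) * sin (starAngle x 1) *
    sin (starAngle x 2) by rw [hkdef]; ring]
  field_simp
  ring

end SphericalTriangle

/-! ### Cutting the octahedron into four tetrahedra. -/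

/-- The reflection changing the sign of the `k`-th coordinate. -/
def negCoord (k : Fin 3) (y : Fin 3 → ℝ) : Fin 3 → ℝ := fun i => if i = k then -y i else y i

theorem negCoord_negCoord (k : Fin 3) (y : Fin 3 → ℝ) : negCoord k (negCoord k y) = y := by
  ext i
  by_cases h : i = k <;> simp [negCoord, h]

theorem measurable_negCoord (k : Fin 3) : Measurable (negCoord k) := by
  refine measurable_pi_lambda _ fun i => ?_
  by_cases h : i = k <;> simp only [negCoord, h, if_true, if_false] <;> fun_prop

theorem measurableSet_posTetrahedron : MeasurableSet posTetrahedron := by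
  unfold posTetrahedron; measurability

/-- The interior of the standard octahedron. -/
def openOctahedron : Set (Fin 3 → ℝ) := {y | |y 0| + |y 1| + |y 2| < 1}

theorem isOpen_openOctahedron : IsOpen openOctahedron :=
  isOpen_lt (by fun_prop) continuous_const

theorem convex_openOctahedron : Convex ℝ openOctahedron := by
  intro y hy z hz a b ha hb hab
  have h : ∀ i, |(a • y + b • z) i| ≤ a * |y i| + b * |z i| := fun i => by
    simp only [Pi.add_apply, Pi.smul_apply, smul_eq_mul]
    refine (abs_add_le _ _).trans ?_
    rw [abs_mul, abs_mul, abs_of_nonneg ha, abs_of_nonneg hb]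
  have hy : |y 0| + |y 1| + |y 2| < 1 := hy
  have hz : |z 0| + |z 1| + |z 2| < 1 := hz
  have := h 0
  have := h 1
  have := h 2
  have key : a * (|y 0| + |y 1| + |y 2|) + b * (|z 0| + |z 1| + |z 2|) < 1 := by
    rcases ha.eq_or_lt with rfl | ha
    · rw [zero_add] at hab; subst hab; linarith
    · nlinarith [mul_lt_mul_of_pos_left hy ha, mul_le_mul_of_nonneg_left hz.le hb]
  show |(a • y + b • z) 0| + |(a • y + b • z) 1| + |(a • y + b • z) 2| < 1
  linarith

/-- The planes y₁ = 0 and y₂ = 0, which are null sets, cut the octahedron into four pieces around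
the 0-axis. -/
theorem lintegral_openOctahedron (f : (Fin 3 → ℝ) → ENNReal) :
    ∫⁻ y in openOctahedron, f y =
      (∫⁻ y in posTetrahedron, f y) + (∫⁻ y in negCoord 2 ⁻¹' posTetrahedron, f y) +
      ((∫⁻ y in negCoord 1 ⁻¹' posTetrahedron, f y) +
        ∫⁻ y in negCoord 1 ⁻¹' (negCoord 2 ⁻¹' posTetrahedron), f y) := by
  have hm := measurableSet_posTetrahedron
  have hm1 := measurable_negCoord 1
  have hm2 := measurable_negCoord 2
  rw [← lintegral_union (hm2 hm), ← lintegral_union (hm1 (hm2 hm)),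
    ← lintegral_union ((hm1 hm).union (hm1 (hm2 hm)))]
  · refine setLIntegral_congr ?_
    have h1 : volume {y : Fin 3 → ℝ | y 1 = 0} = 0 := Measure.pi_hyperplane _ 1 0
    have h2 : volume {y : Fin 3 → ℝ | y 2 = 0} = 0 := Measure.pi_hyperplane _ 2 0
    filter_upwards [compl_mem_ae_iff.2 h1, compl_mem_ae_iff.2 h2] with y hy1 hy2
    refine propext ?_
    change |y 0| + |y 1| + |y 2| < 1 ↔ _
    have hy1 : y 1 ≠ 0 := hy1
    have hy2 : y 2 ≠ 0 := hy2
    change _ ↔ y ∈ posTetrahedron ∪ negCoord 2 ⁻¹' posTetrahedron ∪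
      (negCoord 1 ⁻¹' posTetrahedron ∪ negCoord 1 ⁻¹' (negCoord 2 ⁻¹' posTetrahedron))
    simp only [mem_union, mem_preimage, posTetrahedron, mem_ofPred_eq, negCoord]
    rcases hy1.lt_or_gt with h1 | h1 <;> rcases hy2.lt_or_gt with h2 | h2 <;>
      simp [abs_of_neg, abs_of_pos, h1, h2, not_lt_of_gt]
  · refine disjoint_left.2 fun y hy hy' => ?_
    rcases hy with hy | hy <;> rcases hy' with hy' | hy' <;>
      simp [posTetrahedron, negCoord] at hy hy' <;> linarith
  · refine disjoint_left.2 fun y hy hy' => ?_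
    simp [posTetrahedron, negCoord] at hy hy'; linarith
  · refine disjoint_left.2 fun y hy hy' => ?_
    simp [posTetrahedron, negCoord] at hy hy'; linarith

namespace SphericalTriangle

variable (T : SphericalTriangle)

/-- The adjacent triangle in which the `k`-th vertex is replaced by its antipode. -/
noncomputable def flip (k : Fin 3) : SphericalTriangle where
  vertex i := if i = k then -T.vertex i else T.vertex i
  norm_vertex i := by split_ifs <;> simp [T.norm_vertex]
  linearIndependent := by
    have h := T.linearIndependent.units_smul fun i => if i = k then -1 else 1
    convert h using 1
    ext1 i
    by_cases hi : i = k <;> simp [hi]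

theorem flip_vertex (k i : Fin 3) :
    (T.flip k).vertex i = if i = k then -T.vertex i else T.vertex i := rfl

theorem toMap_flip (k : Fin 3) (y : Fin 3 → ℝ) :
    (T.flip k).toMap y = T.toMap (negCoord k y) := by
  simp only [toMap, Fintype.linearCombination_apply, flip_vertex, negCoord]
  refine Finset.sum_congr rfl fun i _ => ?_
  split_ifs <;> simp

theorem toMap_flip_image (k : Fin 3) (Q : Set (Fin 3 → ℝ)) :
    (T.flip k).toMap '' Q = T.toMap '' (negCoord k ⁻¹' Q) := by
  have h : negCoord k '' Q = negCoord k ⁻¹' Q :=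
    congrFun (image_eq_preimage_of_inverse (negCoord_negCoord k) (negCoord_negCoord k)) Q
  rw [← h, image_image]
  exact image_congr fun y _ => T.toMap_flip k y

theorem tangent_flip (k i j : Fin 3) (hij : i ≠ j) :
    (T.flip k).tangent i j = if j = k then -T.tangent i j else T.tangent i j := by
  simp only [tangent, flip_vertex]
  by_cases hi : i = k
  · have hj : j ≠ k := fun h => hij (hi.trans h.symm)
    simp [hi, hj]
  · by_cases hj : j = k
    · simp [hi, hj]
      abel
    · simp [hi, hj]

/-- At vertex `k` both tangents keep their direction; at any other vertex exactly one of them is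
reversed. -/
theorem innerAngle_flip (k i : Fin 3) :
    (T.flip k).innerAngle i = if i = k then T.innerAngle i else π - T.innerAngle i := by
  have h1 : i ≠ i + 1 := by revert i; decide
  have h2 : i ≠ i + 2 := by revert i; decide
  rw [innerAngle, tangent_flip _ _ _ _ h1, tangent_flip _ _ _ _ h2, innerAngle]
  by_cases hi : i = k
  · subst hi
    simp
  · rw [if_neg hi]
    have h3 : (i + 1 = k ∧ i + 2 ≠ k) ∨ (i + 1 ≠ k ∧ i + 2 = k) := by
      revert i k; decide
    rcases h3 with ⟨ha, hb⟩ | ⟨ha, hb⟩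
    · rw [if_pos ha, if_neg hb, InnerProductGeometry.angle_neg_left]
    · rw [if_neg ha, if_pos hb, InnerProductGeometry.angle_neg_right]

/-- Under the flips the axis angle is `x 0` twice and π - `x 0` twice, which cancels by oddness and
periodicity of Λ. Every xᵢ* and σ - π occurs twice among the remaining star angles. -/
theorem lintegral_image_openOctahedron :
    0 ≤ -(2 * potential T.innerAngle) ∧
    ∫⁻ p in T.toMap '' openOctahedron, ENNReal.ofReal (kleinDensity p) =
      ENNReal.ofReal (-(2 * potential T.innerAngle)) := by
  have hm := measurableSet_posTetrahedron
  have hm1 := measurable_negCoord 1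
  have hm2 := measurable_negCoord 2
  obtain ⟨a1, b1⟩ := T.lintegral_tetrahedron
  obtain ⟨a2, b2⟩ := (T.flip 2).lintegral_tetrahedron
  obtain ⟨a3, b3⟩ := (T.flip 1).lintegral_tetrahedron
  obtain ⟨a4, b4⟩ := ((T.flip 1).flip 2).lintegral_tetrahedron
  have hsum : -(2 * potential T.innerAngle) =
      lobachevsky (T.innerAngle 0) + lobachevsky (starAngle T.innerAngle 1) +
        lobachevsky (starAngle T.innerAngle 2) +
      (lobachevsky ((T.flip 2).innerAngle 0) + lobachevsky (starAngle (T.flip 2).innerAngle 1) +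
        lobachevsky (starAngle (T.flip 2).innerAngle 2)) +
      (lobachevsky ((T.flip 1).innerAngle 0) + lobachevsky (starAngle (T.flip 1).innerAngle 1) +
        lobachevsky (starAngle (T.flip 1).innerAngle 2) +
      (lobachevsky (((T.flip 1).flip 2).innerAngle 0) +
        lobachevsky (starAngle ((T.flip 1).flip 2).innerAngle 1) +
        lobachevsky (starAngle ((T.flip 1).flip 2).innerAngle 2))) := by
    have e : lobachevsky ((π + T.innerAngle 0 + T.innerAngle 1 + T.innerAngle 2) / 2) =
        lobachevsky ((T.innerAngle 0 + T.innerAngle 1 + T.innerAngle 2 - π) / 2) := by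
      rw [← lobachevsky_add_pi ((_ - π) / 2)]; congr 1; ring
    rw [potential, e]
    simp only [starAngle, innerAngle_flip, Fin.sum_univ_three, zero_add, Fin.isValue,
      Fin.reduceAdd, Fin.reduceEq, if_true, if_false, lobachevsky_pi_sub]
    ring_nf
  rw [hsum]
  refine ⟨by positivity, ?_⟩
  have himage : ∀ Q : Set (Fin 3 → ℝ), MeasurableSet Q → ENNReal.ofReal |T.mat.det| *
      ∫⁻ y in Q, ENNReal.ofReal (kleinDensity (T.toMap y)) =
      ∫⁻ p in T.toMap '' Q, ENNReal.ofReal (kleinDensity p) := fun Q hQ =>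
    (T.lintegral_image_toMap hQ fun p => ENNReal.ofReal (kleinDensity p)).symm
  rw [T.lintegral_image_toMap isOpen_openOctahedron.measurableSet, lintegral_openOctahedron,
    mul_add, mul_add, mul_add, himage _ hm, himage _ (hm2 hm), himage _ (hm1 hm),
    himage _ (hm1 (hm2 hm)),
    ← toMap_flip_image, ← toMap_flip_image, ← toMap_flip_image, ← toMap_flip_image,
    b1, b2, b3, b4, ← ENNReal.ofReal_add a1 a2, ← ENNReal.ofReal_add a3 a4,
    ← ENNReal.ofReal_add (add_nonneg a1 a2) (add_nonneg a3 a4)]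

/-! ### The six ideal vertices and their convex hull. -/

theorem toMap_single (k : Fin 3) (s : ℝ) : T.toMap (Pi.single k s) = s • T.vertex k :=
  Fintype.linearCombination_apply_single ℝ T.vertex k s

theorem toMap_surjective : Function.Surjective T.toMap :=
  (LinearMap.injective_iff_surjective_of_finrank_eq_finrank (by simp)).1 T.toMap_injective

theorem toMap_mem_boundingCircle (i : Fin 3) (y : Fin 3 → ℝ) :
    T.toMap y ∈ T.boundingCircle i ↔ ‖T.toMap y‖ = 1 ∧ y i = 0 := by
  refine and_congr_right fun _ => ?_
  rw [Submodule.mem_span_pair]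
  constructor
  · rintro ⟨a, b, h⟩
    rw [← toMap_single, ← toMap_single, ← map_add] at h
    have h1 : i ≠ i + 1 := by clear h; revert i; decide
    have h2 : i ≠ i + 2 := by clear h h1; revert i; decide
    rw [← T.toMap_injective h]
    simp [h1, h2]
  · intro h
    refine ⟨y (i + 1), y (i + 2), ?_⟩
    rw [toMap_apply]
    fin_cases i
    · simp at h ⊢; simp [h]
    · simp at h ⊢; simp [h]; abel
    · simp at h ⊢; simp [h]

/-- In vertex coordinates the great circles lie in the coordinate planes; two of these meet in an
axis, whose unit vectors are a vertex and its antipode. -/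
theorem intersectionPoints_eq : T.intersectionPoints =
    range fun q : Fin 3 × Bool => T.toMap (Pi.single q.1 (if q.2 then 1 else -1)) := by
  ext p
  constructor
  · rintro ⟨i, j, hij, hi, hj⟩
    obtain ⟨y, rfl⟩ := T.toMap_surjective p
    rw [toMap_mem_boundingCircle] at hi hj
    obtain ⟨k, hk⟩ : ∃ k : Fin 3, ∀ l, l ≠ k → l = i ∨ l = j := by
      clear hi hj; revert i j; decide
    have hy : y = Pi.single k (y k) := by
      ext l
      by_cases hl : l = k
      · subst hl; simp
      · rw [Pi.single_eq_of_ne hl]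
        rcases hk l hl with rfl | rfl
        · exact hi.2
        · exact hj.2
    have hn := hi.1
    rw [hy, toMap_single, norm_smul, T.norm_vertex, mul_one, Real.norm_eq_abs] at hn
    rcases (abs_eq zero_le_one).1 hn with h | h
    · exact ⟨(k, true), by rw [hy, h]; simp⟩
    · exact ⟨(k, false), by rw [hy, h]; simp⟩
  · rintro ⟨⟨k, b⟩, rfl⟩
    refine ⟨k + 1, k + 2, by revert k; decide, ?_, ?_⟩ <;>
      rw [toMap_mem_boundingCircle] <;> refine ⟨?_, ?_⟩
    · rw [toMap_single, norm_smul, T.norm_vertex]; cases b <;> simp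
    · simp
    · rw [toMap_single, norm_smul, T.norm_vertex]; cases b <;> simp
    · simp

theorem ncard_intersectionPoints : T.intersectionPoints.ncard = 6 := by
  have hinj : Function.Injective
      fun q : Fin 3 × Bool => T.toMap (Pi.single q.1 (if q.2 then 1 else -1)) := by
    rintro ⟨k, b⟩ ⟨l, c⟩ h
    have h := T.toMap_injective h
    have h1 := congrFun h k
    simp only [Pi.single_eq_same] at h1
    have hkl : k = l := by
      by_contra hkl
      rw [Pi.single_eq_of_ne hkl] at h1
      cases b <;> simp at h1
    subst hkl
    simp only [Pi.single_eq_same] at h1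
    cases b <;> cases c <;> simp at h1 ⊢ <;> norm_num at h1
  rw [intersectionPoints_eq, ← image_univ, ncard_image_of_injective _ hinj, ncard_univ]
  simp

theorem vertex_mem (k : Fin 3) :
    T.vertex k ∈ T.octahedron ∧ -T.vertex k ∈ T.octahedron := by
  constructor <;> refine subset_convexHull ℝ _ ?_ <;> rw [intersectionPoints_eq]
  · exact ⟨(k, true), by simp [toMap_single]⟩
  · exact ⟨(k, false), by simp [toMap_single]⟩

theorem image_openOctahedron_subset : T.toMap '' openOctahedron ⊆ T.octahedron := by
  rintro _ ⟨y, hy, rfl⟩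
  have hy : |y 0| + |y 1| + |y 2| < 1 := hy
  have hconv : Convex ℝ T.octahedron := convex_convexHull ℝ _
  have hsgn : ∀ k, ∃ q ∈ T.octahedron, |y k| • q = y k • T.vertex k := by
    intro k
    rcases abs_cases (y k) with ⟨h, _⟩ | ⟨h, _⟩
    · exact ⟨_, (T.vertex_mem k).1, by rw [h]⟩
    · exact ⟨_, (T.vertex_mem k).2, by rw [h]; simp⟩
  choose q hq hqy using hsgn
  have h0 : (0 : E3) ∈ T.octahedron := by
    have := hconv (T.vertex_mem 0).1 (T.vertex_mem 0).2 (a := 1 / 2) (b := 1 / 2) (by norm_num)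
      (by norm_num) (by norm_num)
    simpa using this
  -- Weight |yₖ| goes to the vertex ±vₖ of matching sign, and the remaining weight to the centre 0.
  have h := hconv.sum_mem (t := Finset.univ) (w := ![1 - |y 0| - |y 1| - |y 2|, |y 0|, |y 1|, |y 2|])
    (z := ![0, q 0, q 1, q 2]) (fun i _ => ?_) (by simp [Fin.sum_univ_four]; ring) (fun i _ => ?_)
  · rw [toMap_apply]
    simpa [Fin.sum_univ_four, hqy] using h
  · fin_cases i <;> simp
    linarith
  · fin_cases i <;> simp [h0, hq]

theorem image_openOctahedron_subset_ball : T.toMap '' openOctahedron ⊆ Metric.ball 0 1 := by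
  rintro _ ⟨y, hy, rfl⟩
  have hy : |y 0| + |y 1| + |y 2| < 1 := hy
  rw [mem_ball_zero_iff, toMap_apply]
  refine (norm_add₃_le).trans_lt ?_
  simpa [norm_smul, T.norm_vertex] using hy

theorem isOpen_image_openOctahedron : IsOpen (T.toMap '' openOctahedron) :=
  T.toMap.isOpenMap_of_finiteDimensional T.toMap_surjective _ isOpen_openOctahedron

theorem octahedron_subset_closure : T.octahedron ⊆ closure (T.toMap '' openOctahedron) := by
  refine convexHull_min ?_ (convex_openOctahedron.linear_image T.toMap).closure
  rw [intersectionPoints_eq]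
  rintro _ ⟨⟨k, b⟩, rfl⟩
  refine image_closure_subset_closure_image T.toMap.continuous_of_finiteDimensional
    (mem_image_of_mem _ ?_)
  have hlim : Tendsto (fun t : ℝ => t • (Pi.single k (if b then 1 else -1) : Fin 3 → ℝ)) (𝓝[<] 1)
      (𝓝 ((1 : ℝ) • (Pi.single k (if b then 1 else -1) : Fin 3 → ℝ))) :=
    (Continuous.tendsto (by fun_prop) _).mono_left nhdsWithin_le_nhds
  rw [one_smul] at hlim
  refine mem_closure_of_tendsto hlim ?_
  filter_upwards [Ioo_mem_nhdsLT (zero_lt_one' ℝ)] with t ht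
  change |(_ : ℝ)| + |(_ : ℝ)| + |(_ : ℝ)| < 1
  have : |t| < 1 := abs_lt.2 ⟨by linarith [ht.1], ht.2⟩
  fin_cases k <;> cases b <;> simpa using this

/-- The hull lies between the open convex image, which is inside the ball, and its closure; the
frontier of a convex set is null. -/
theorem hyperbolicVolume_octahedron : hyperbolicVolume T.octahedron =
    ENNReal.ofReal (-(2 * potential T.innerAngle)) := by
  rw [← T.lintegral_image_openOctahedron.2, hyperbolicVolume]
  refine setLIntegral_congr ?_
  have hnull := (convex_openOctahedron.linear_image T.toMap).addHaar_frontier volume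
  rw [T.isOpen_image_openOctahedron.frontier_eq] at hnull
  refine ae_eq_set.2 ⟨measure_mono_null ?_ hnull, ?_⟩
  · exact sdiff_subset_sdiff_left (inter_subset_left.trans T.octahedron_subset_closure)
  · rw [sdiff_eq_empty.2 (subset_inter T.image_openOctahedron_subset
      T.image_openOctahedron_subset_ball), measure_empty]

end SphericalTriangle

end TriangleCapacity

open TriangleCapacity in
theorem proposition3p1 :
    -- the domains are the spaces of triangles, and the inner angles determine the edge lengths
    (Set.range SphericalTriangle.innerAngle = sphericalDomain ∧
      ∀ T : SphericalTriangle, T.edge = sphericalEdge T.innerAngle) ∧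
    (Set.range HyperbolicTriangle.innerAngle = hyperbolicDomain ∧
      ∀ T : HyperbolicTriangle, T.edge = hyperbolicEdge T.innerAngle) ∧
    -- the two capacities are well defined: the integrals exist and do not depend on the path
    (∀ x ∈ sphericalDomain, ∀ γ : Path basePoint x, IsPiecewiseC1 γ →
      (∀ t, γ t ∈ sphericalDomain) →
        CurveIntegrable sphericalForm γ ∧ curveIntegral sphericalForm γ = sphericalCapacity x) ∧
    (∀ x ∈ hyperbolicDomain, ∀ γ : Path 0 x, IsPiecewiseC1 γ →
      (∀ t, t ≠ 0 → γ t ∈ hyperbolicDomain) →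
        CurveIntegrable hyperbolicForm γ ∧
          curveIntegral hyperbolicForm γ = hyperbolicCapacity x) ∧
    -- the explicit formulas
    (∀ x ∈ sphericalDomain, sphericalCapacity x =
      -(∑ i, lobachevsky (starAngle x i)) - lobachevsky ((Real.pi + x 0 + x 1 + x 2) / 2)
        + 4 * lobachevsky (Real.pi / 4)) ∧
    (∀ x ∈ hyperbolicDomain, hyperbolicCapacity x =
      -(∑ i, lobachevsky (starAngle x i)) - lobachevsky ((Real.pi + x 0 + x 1 + x 2) / 2)) ∧
    -- the continuous extensions
    (∃ g : (Fin 3 → ℝ) → ℝ, ContinuousOn g (closure sphericalDomain) ∧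
      Set.EqOn g sphericalCapacity sphericalDomain) ∧
    (∃ g : (Fin 3 → ℝ) → ℝ, ContinuousOn g (closure hyperbolicDomain) ∧
      Set.EqOn g hyperbolicCapacity hyperbolicDomain) ∧
    -- the volume of the ideal octahedron with six ideal vertices
    (∀ T : SphericalTriangle, T.intersectionPoints.ncard = 6 ∧
      hyperbolicVolume T.octahedron ≠ ⊤ ∧
      8 * lobachevsky (Real.pi / 4) - 2 * sphericalCapacity T.innerAngle =
        (hyperbolicVolume T.octahedron).toReal) := by
  refine ⟨⟨SphericalTriangle.range_innerAngle, fun T => T.edge_eq_sphericalEdge⟩,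
    ⟨HyperbolicTriangle.range_innerAngle, fun T => T.edge_eq_hyperbolicEdge⟩,
    fun x hx γ hγ hγD => ?_, fun x hx γ hγ hγD => ?_, fun x hx => ?_, fun x hx => ?_,
    ⟨fun x => potential x + 4 * lobachevsky (Real.pi / 4), ?_, fun x hx => ?_⟩,
    ⟨potential, continuous_potential.continuousOn, fun x hx => (hyperbolicCapacity_eq hx).symm⟩,
    fun T => ⟨T.ncard_intersectionPoints, ?_, ?_⟩⟩
  · rw [sphericalCapacity_eq hx]
    exact curveIntegral_sphericalForm γ hγ hγD
  · rw [hyperbolicCapacity_eq hx]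
    exact curveIntegral_hyperbolicForm γ hγ hγD
  · rw [sphericalCapacity_eq hx, potential]
  · rw [hyperbolicCapacity_eq hx, potential]
  · exact (continuous_potential.add continuous_const).continuousOn
  · exact (sphericalCapacity_eq hx).symm
  · rw [T.hyperbolicVolume_octahedron]
    exact ENNReal.ofReal_ne_top
  · rw [T.hyperbolicVolume_octahedron,
      ENNReal.toReal_ofReal T.lintegral_image_openOctahedron.1,
      sphericalCapacity_eq T.innerAngle_mem_sphericalDomain]
    ring
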